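/- Let $0<T\le\infty$, let $\Omega\subseteq\mathbb R^3$ be open, and call a pair $(\mathbf u,\boldsymbol\omega)$ of vector fields on $[0,T)\times\Omega$ a *smooth vorticity flow* if $\mathbf u$ and $\boldsymbol\omega$ are $C^\infty$ on $[0,T)\times\Omega$, and there $$\nabla\cdot\mathbf u=0,\qquad \boldsymbol\omega=\nabla\times\mathbf u,\qquad \partial_t\boldsymbol\omega=(\boldsymbol\omega\cdot\nabla)\mathbf u-(\mathbf u\cdot\nabla)\boldsymbol\omega ,$$ and $\sup_{[0,\tau]\times\Omega}|\nabla\mathbf u|<\infty$ for every $\tau\in[0,T)$. (a) Whole space. Let $(\mathbf u_1,\boldsymbol\omega_1)$ and $(\mathbf u_2,\boldsymbol\omega_2)$ be smooth vorticity flows on $[0,T)\times\mathbb R^3$ with compactly supported initial vorticities and with finite energy, i.e. $\sup_{0\le t\le\tau}\int_{\mathbb R^3}|\mathbf u_i(\mathbf x,t)|^2\,d\mathbf x<\infty$ for every $\tau\in[0,T)$, $i=1,2$. If $\boldsymbol\omega_1(\cdot,0)=\boldsymbol\omega_2(\cdot,0)$, then $\boldsymbol\omega_1=\boldsymbol\omega_2$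 and $\mathbf u_1=\mathbf u_2$ on $[0,T)\times\mathbb R^3$. (b) Bounded domains. Let $\Omega\subset\mathbb R^3$ be a bounded, simply connected domain with $C^2$ boundary (lying locally on one side of it) and outward unit normal $\vec n$. Let $(\mathbf u_1,\boldsymbol\omega_1)$ and $(\mathbf u_2,\boldsymbol\omega_2)$ be smooth vorticity flows on $[0,T)\times\Omega$ whose velocities extend continuously to $[0,T)\times\overline\Omega$ and satisfy $\mathbf u_i\cdot\vec n=0$ on $[0,T)\times\partial\Omega$, $i=1,2$. If $\boldsymbol\omega_1(\cdot,0)=\boldsymbol\omega_2(\cdot,0)$ on $\Omega$, then $\boldsymbol\omega_1=\boldsymbol\omega_2$ and $\mathbf u_1=\mathbf u_2$ on $[0,T)\times\Omega$. For $T=\infty$ this is uniqueness for all times. -/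

import Mathlib

noncomputable section

namespace Euler3D

/-- Physical space, with its Euclidean norm. -/
abbrev E3 : Type := EuclideanSpace ℝ (Fin 3)

/-- The partial derivative `∂ᵢ vⱼ` at `x` of a vector field `v`. -/
def partialDeriv (v : E3 → E3) (x : E3) (i j : Fin 3) : ℝ :=
  fderiv ℝ v x (EuclideanSpace.single i 1) j

/-- The divergence of a vector field. -/
def divergence (v : E3 → E3) (x : E3) : ℝ :=
  ∑ i, partialDeriv v x i i

/-- The curl of a vector field. -/
def curl (v : E3 → E3) (x : E3) : E3 :=
  !₂[partialDeriv v x 1 2 - partialDeriv v x 2 1,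
     partialDeriv v x 2 0 - partialDeriv v x 0 2,
     partialDeriv v x 0 1 - partialDeriv v x 1 0]

/-- The time interval `[0, T)`, where `T = ⊤` is allowed. -/
def timeInterval (T : EReal) : Set ℝ := {t : ℝ | 0 ≤ t ∧ (t : EReal) < T}

/-- `ρ` is a `C²` defining function of `Ω` on the open neighbourhood `U` of `p`: its gradient at `p`
does not vanish, and inside `U` the set `Ω` is `{ρ < 0}`. -/
structure IsC2DefiningFunction (Ω : Set E3) (p : E3) (U : Set E3) (ρ : E3 → ℝ) : Prop where
  isOpen : IsOpen U
  mem : p ∈ U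
  contDiffOn : ContDiffOn ℝ 2 ρ U
  gradient_ne_zero : gradient ρ p ≠ 0
  mem_iff : ∀ x ∈ U, x ∈ Ω ↔ ρ x < 0

/-- `Ω` has a `C²` boundary, and lies locally on one side of it. -/
def HasC2Boundary (Ω : Set E3) : Prop :=
  ∀ p ∈ frontier Ω, ∃ (U : Set E3) (ρ : E3 → ℝ), IsC2DefiningFunction Ω p U ρ

/-- `n` is the outward unit normal of `Ω` at the boundary point `p`. -/
def IsOutwardUnitNormal (Ω : Set E3) (p n : E3) : Prop :=
  ∃ (U : Set E3) (ρ : E3 → ℝ), IsC2DefiningFunction Ω p U ρ ∧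
    n = ‖gradient ρ p‖⁻¹ • gradient ρ p

/-- `u` and `ω` are smooth in space-time on `[0, T) × Ω`, `u` is solenoidal, `ω` is its vorticity,
the vorticity equation `∂ₜω = (ω·∇)u - (u·∇)ω` holds (with the one-sided time derivative at
`t = 0`), and the velocity gradient is bounded on `[0, τ] × Ω` for every `τ < T`. -/
structure IsSmoothVorticityFlow (Ω : Set E3) (T : EReal) (u ω : ℝ → E3 → E3) : Prop where
  smooth_velocity :
    ContDiffOn ℝ (⊤ : ℕ∞) (fun z : ℝ × E3 => u z.1 z.2) (timeInterval T ×ˢ Ω)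
  smooth_vorticity :
    ContDiffOn ℝ (⊤ : ℕ∞) (fun z : ℝ × E3 => ω z.1 z.2) (timeInterval T ×ˢ Ω)
  divergence_free : ∀ t ∈ timeInterval T, ∀ x ∈ Ω, divergence (u t) x = 0
  vorticity_eq_curl : ∀ t ∈ timeInterval T, ∀ x ∈ Ω, ω t x = curl (u t) x
  vorticity_equation : ∀ t ∈ timeInterval T, ∀ x ∈ Ω,
    HasDerivWithinAt (fun s : ℝ => ω s x)
      (fderiv ℝ (u t) x (ω t x) - fderiv ℝ (ω t) x (u t x)) (timeInterval T) t
  bounded_gradient : ∀ τ ∈ timeInterval T, ∃ M : ℝ, ∀ t ∈ Set.Icc 0 τ, ∀ x ∈ Ω,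
    ‖fderiv ℝ (u t) x‖ ≤ M

/-- A smooth finite-energy vorticity solution in the whole space whose initial vorticity is
compactly supported. -/
structure IsWholeSpaceSolution (T : EReal) (u ω : ℝ → E3 → E3) : Prop extends
    IsSmoothVorticityFlow Set.univ T u ω where
  compactly_supported_data : HasCompactSupport (ω 0)
  finite_energy : ∀ τ ∈ timeInterval T, ∃ E : ℝ, ∀ t ∈ Set.Icc 0 τ,
    MeasureTheory.Integrable (fun x : E3 => ‖u t x‖ ^ 2) ∧ ∫ x : E3, ‖u t x‖ ^ 2 ≤ E

/-- A smooth vorticity solution in a domain `Ω` with impermeable boundary: the velocity is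
continuous up to the boundary and has zero normal component there. -/
structure IsImpermeableDomainSolution (Ω : Set E3) (T : EReal) (u ω : ℝ → E3 → E3) : Prop extends
    IsSmoothVorticityFlow Ω T u ω where
  continuous_velocity :
    ContinuousOn (fun z : ℝ × E3 => u z.1 z.2) (timeInterval T ×ˢ closure Ω)
  zero_normal_velocity : ∀ t ∈ timeInterval T, ∀ p ∈ frontier Ω, ∀ n : E3,
    IsOutwardUnitNormal Ω p n → inner ℝ (u t p) n = 0

end Euler3D

end

/-!
Uniqueness is proved by an energy estimate for the difference `w = u₁ - u₂` of the velocities. It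
uses neither a pressure nor a time derivative of the velocity.

For a solenoidal velocity `u` with vorticity `ω`, `∇ × (u·∇)u = (u·∇)ω - (ω·∇)u`
(`curl_convection`). Hence the vorticity equation, integrated in time, says that the momentum defect
`u(t) - u(s) + ∫ₛᵗ (u·∇)u` is curl-free (`IsSmoothVorticityFlow.curl_momentumDefect`). Curl-free
fields are orthogonal in `L²` to the solenoidal field `w(a)` at every time `a`; so the increments of
`w`, tested against the values of `w`, are given by the difference `G` of the convective terms. This
weak form of `w' = G` is enough for Grönwall's inequality (`eq_zero_of_weak_evolution`): testing an
increment against itself shows that `w` is Lipschitz in `L²`, and then `‖w‖²` has upper derivative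
at most `2 ⟨G, w⟩ = -2 ∫ (w·∇)u₂ · w - ∫ u₁·∇|w|²`. The last integral vanishes because `u₁` is
solenoidal, and the first is at most `M ‖w‖²` in size, as the velocity gradients are bounded.
Initially, `w(0)` is curl-free, hence orthogonal to itself, hence zero. The vorticities agree as the
curls of the velocities.

It remains to see that curl-free fields are orthogonal to solenoidal ones.

In the whole space, both fields are square integrable (`integral_inner_eq_zero_of_curl_eq_zero`). A
curl-free field `F` is a gradient `∇Q`, but `Q` may fail to be square integrable. Yet
`F(· + h) - F` has the square integrable potential `Q(· + h) - Q`, so a cut-off at a large radius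
shows that `∫ F(x + h) · v(x) dx` does not depend on `h`, and this correlation tends to zero as
`|h| → ∞`.

In a bounded domain, `F` is bounded and `v` is tangential
(`setIntegral_inner_eq_zero_of_curl_eq_zero`). The germs of primitives of the closed one-form `F`
form a covering space of the domain, which has a global section since the domain is simply connected
(`exists_hasFDerivAt_of_simplyConnected`); so `F = ∇Q`, and `Q` is bounded because the domain
contains segments of a fixed length ending at each of its points near the boundary
(`exists_abs_le_of_hasFDerivAt`). Cutting `Q` off in a thin layer along the boundary produces an
error that involves only the normal component of `v`, which is small in the layer, against a weight
whose total mass stays bounded (`setIntegral_layer_le`). Continuity of `v` up to the boundary is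
thus all that is needed there, and no trace or divergence theorem on the domain enters.
-/

namespace Euler3D

open Set Filter Topology MeasureTheory
open scoped Interval

/-! ### Closed one-forms on simply connected open sets -/

/-- The real line with the discrete topology: the fibre of the covering space of local primitives
of a closed one-form. -/
@[ext]
structure DiscreteReal : Type where
  /-- The underlying real number. -/
  val : ℝ

instance : TopologicalSpace DiscreteReal := ⊥

instance : DiscreteTopology DiscreteReal := ⟨rfl⟩

section Primitive

variable {E : Type*} [NormedAddCommGroup E] [NormedSpace ℝ E]

/-- The covering space of local primitives. Given a primitive `f i` of a one-form on the ball of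
radius `r i` around each point `i` of `Ω`, the point `(x, c)` in the chart `i` stands for the germ
of `f i + c` at `x`. -/
def primitiveCore {Ω : Set E} {ω : E → E →L[ℝ] ℝ} (r : Ω → ℝ) (hr : ∀ i, 0 < r i)
    (f : Ω → E → ℝ)
    (hf : ∀ i : Ω, ∀ x ∈ Metric.ball (i : E) (r i), HasFDerivAt (f i) (ω x) x) :
    FiberBundleCore Ω Ω DiscreteReal where
  baseSet i := Subtype.val ⁻¹' Metric.ball (i : E) (r i)
  isOpen_baseSet i := Metric.isOpen_ball.preimage continuous_subtype_val
  indexAt x := x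
  mem_baseSet_at x := Metric.mem_ball_self (hr x)
  coordChange i j x c := ⟨c.val + (f i x - f j x)⟩
  coordChange_self i x _ v := by simp
  continuousOn_coordChange i j := by
    have hconv : Convex ℝ (Metric.ball (i : E) (r i) ∩ Metric.ball (j : E) (r j)) :=
      (convex_ball _ _).inter (convex_ball _ _)
    -- the two primitives differ by a constant on the overlap, which is convex
    have hconst : ∀ x ∈ Metric.ball (i : E) (r i) ∩ Metric.ball (j : E) (r j),
        ∀ y ∈ Metric.ball (i : E) (r i) ∩ Metric.ball (j : E) (r j),
          f i x - f j x = f i y - f j y := by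
      intro x hx y hy
      have h : ∀ z ∈ Metric.ball (i : E) (r i) ∩ Metric.ball (j : E) (r j),
          HasFDerivAt (fun z => f i z - f j z) (0 : E →L[ℝ] ℝ) z := fun z hz => by
        simpa using! (hf i z hz.1).sub (hf j z hz.2)
      exact hconv.is_const_of_fderivWithin_eq_zero (𝕜 := ℝ) (f := fun z => f i z - f j z)
        (fun z hz => (h z hz).differentiableAt.differentiableWithinAt)
        (fun z hz => (h z hz).hasFDerivWithinAt.fderivWithin
          ((Metric.isOpen_ball.inter Metric.isOpen_ball).uniqueDiffOn z hz)) hx hy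
    rintro ⟨x, c⟩ hxc
    have hg : Continuous fun p : Ω × DiscreteReal =>
        (⟨p.2.val + (f i x - f j x)⟩ : DiscreteReal) :=
      (continuous_of_discreteTopology (f := fun c : DiscreteReal =>
        (⟨c.val + (f i x - f j x)⟩ : DiscreteReal))).comp continuous_snd
    refine hg.continuousOn.congr (fun p hp => ?_) _ hxc
    simp only [hconst p.1 hp.1 x hxc.1]
  coordChange_comp i j k x _ v := by
    ext
    simp only
    ring

/-- A closed one-form on a simply connected open set is exact. The covering space of its local
primitives has a global section, which patches local primitives together. -/
theorem exists_hasFDerivAt_of_simplyConnected {Ω : Set E} (hΩ : IsOpen Ω)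
    (hsc : SimplyConnectedSpace Ω) {ω : E → E →L[ℝ] ℝ} (hω : DifferentiableOn ℝ ω Ω)
    (hsymm : ∀ a ∈ Ω, ∀ x y, fderiv ℝ ω a x y = fderiv ℝ ω a y x) :
    ∃ Q : E → ℝ, ∀ x ∈ Ω, HasFDerivAt Q (ω x) x := by
  classical
  have hball : ∀ i : Ω, ∃ r : ℝ, 0 < r ∧ Metric.ball (i : E) r ⊆ Ω := fun i =>
    Metric.isOpen_iff.1 hΩ i i.2
  choose r hr hrΩ using hball
  have hprim : ∀ i : Ω, ∃ f : E → ℝ, ∀ x ∈ Metric.ball (i : E) (r i), HasFDerivAt f (ω x) x :=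
    fun i => (convex_ball _ _).exists_forall_hasFDerivAt_of_fderiv_symmetric Metric.isOpen_ball
      (hω.mono (hrΩ i)) fun a ha => hsymm a (hrΩ i ha)
  choose f hf using hprim
  let Z := primitiveCore r hr f hf
  have hcov : IsCoveringMap Z.proj := FiberBundle.isCoveringMap (F := DiscreteReal) (E := Z.Fiber)
  have : LocallyPathConnectedSpace Ω := hΩ.locallyPathConnectedSpace
  obtain ⟨x₀⟩ : Nonempty Ω := inferInstance
  obtain ⟨s, ⟨-, hs⟩, -⟩ := hcov.existsUnique_continuousMap_lifts (ContinuousMap.id Ω) x₀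
    (⟨x₀, (⟨0⟩ : DiscreteReal)⟩ : Z.TotalSpace) rfl
  have hproj : ∀ x, (s x).proj = x := fun x => congrFun hs x
  let c : Ω → DiscreteReal := fun x => (s x).snd
  let Q : E → ℝ := fun x => if hx : x ∈ Ω then f ⟨x, hx⟩ x + (c ⟨x, hx⟩).val else 0
  refine ⟨Q, fun x hx => ?_⟩
  have hmem : s ⟨x, hx⟩ ∈ (Z.localTriv ⟨x, hx⟩).source := by
    rw [Z.mem_localTriv_source, hproj]
    exact Metric.mem_ball_self (hr _)
  have hcont : ContinuousAt (fun y => (Z.localTriv ⟨x, hx⟩ (s y)).2) ⟨x, hx⟩ :=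
    continuous_snd.continuousAt.comp
      (((Z.localTriv ⟨x, hx⟩).continuousAt hmem).comp s.continuous.continuousAt)
  have hval : ∀ y : Ω, (Z.localTriv ⟨x, hx⟩ (s y)).2.val = Q y - f ⟨x, hx⟩ y := by
    intro y
    have h1 : (Z.localTriv ⟨x, hx⟩ (s y)).2.val
        = (c y).val + (f (s y).proj (s y).proj - f ⟨x, hx⟩ (s y).proj) := rfl
    rw [h1, hproj]
    simp only [Q, y.2, dite_true]
    ring
  have hev : ∀ᶠ y : Ω in 𝓝 ⟨x, hx⟩, Q y - f ⟨x, hx⟩ y = Q x - f ⟨x, hx⟩ x := by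
    have h1 : ∀ᶠ y : Ω in 𝓝 ⟨x, hx⟩,
        (Z.localTriv ⟨x, hx⟩ (s y)).2 = (Z.localTriv ⟨x, hx⟩ (s ⟨x, hx⟩)).2 :=
      hcont.eventually ((isOpen_discrete {(Z.localTriv ⟨x, hx⟩ (s ⟨x, hx⟩)).2}).mem_nhds rfl)
    filter_upwards [h1] with y hy
    rw [← hval y, hy, hval ⟨x, hx⟩]
  have hev' : Q =ᶠ[𝓝 x] fun y => f ⟨x, hx⟩ y + (Q x - f ⟨x, hx⟩ x) := by
    rw [← map_nhds_subtype_coe_eq_nhds hx (hΩ.mem_nhds hx), EventuallyEq, eventually_map]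
    filter_upwards [hev] with y hy
    linarith
  exact ((hf ⟨x, hx⟩ x (Metric.mem_ball_self (hr _))).add_const _).congr_of_eventuallyEq hev'

end Primitive

/-! ### Solenoidal fields are orthogonal to gradients -/

lemma sum_smul_single (y : E3) : ∑ i, y i • EuclideanSpace.single i (1 : ℝ) = y := by
  ext j
  simp [Fin.sum_univ_three]
  fin_cases j <;> simp

lemma fderiv_apply_eq_sum (ψ : E3 → ℝ) (x y : E3) :
    fderiv ℝ ψ x y = ∑ i, fderiv ℝ ψ x (EuclideanSpace.single i 1) * y i := by
  conv_lhs => rw [← sum_smul_single y]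
  simp [mul_comm]

lemma inner_eq_sum (a b : E3) : inner ℝ a b = ∑ i, a i * b i := by
  simp [PiLp.inner_apply, mul_comm]

/-- The Jacobian matrix of a curl-free field is symmetric. -/
lemma inner_fderiv_comm_of_curl_eq_zero {F : E3 → E3} {x : E3} (h : curl F x = 0) (a b : E3) :
    inner ℝ (fderiv ℝ F x a) b = inner ℝ (fderiv ℝ F x b) a := by
  have h0 := congrFun (congrArg WithLp.ofLp h) 0
  have h1 := congrFun (congrArg WithLp.ofLp h) 1
  have h2 := congrFun (congrArg WithLp.ofLp h) 2
  simp only [curl, partialDeriv, Fin.isValue, PiLp.zero_apply, Matrix.cons_val_zero,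
    Matrix.cons_val_one, Matrix.cons_val] at h0 h1 h2
  rw [← sum_smul_single a, ← sum_smul_single b]
  simp [inner_eq_sum, Fin.sum_univ_three]
  linear_combination (a 1 * b 2 - a 2 * b 1) * h0 + (a 2 * b 0 - a 0 * b 2) * h1
    + (a 0 * b 1 - a 1 * b 0) * h2

/-- The differential of a `C¹` function, paired with a field that is continuous on the support of
the function, is continuous. -/
lemma continuous_fderiv_apply_of_tsupport {ψ : E3 → ℝ} {v : E3 → E3}
    (hψ : ∀ x ∈ tsupport ψ, ContDiffAt ℝ 1 ψ x) (hv : ∀ x ∈ tsupport ψ, ContinuousAt v x) :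
    Continuous fun x => fderiv ℝ ψ x (v x) := by
  refine continuous_of_tsupport fun x hx => ?_
  have hx' : x ∈ tsupport ψ := by
    refine closure_minimal (fun y hy => ?_) (isClosed_tsupport ψ) hx
    by_contra hy'
    exact hy (by simp [fderiv_of_notMem_tsupport ℝ hy'])
  exact ((hψ x hx').continuousAt_fderiv one_ne_zero).clm_apply (hv x hx')

lemma hasCompactSupport_fderiv_apply {ψ : E3 → ℝ} (hc : HasCompactSupport ψ) (v : E3 → E3) :
    HasCompactSupport fun x => fderiv ℝ ψ x (v x) :=
  HasCompactSupport.intro hc fun x hx => by simp [fderiv_of_notMem_tsupport ℝ hx]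

lemma fderiv_coord {v : E3 → E3} {x : E3} (hv : DifferentiableAt ℝ v x) (i : Fin 3) (e : E3) :
    fderiv ℝ (fun y => v y i) x e = fderiv ℝ v x e i := by
  have h := ((EuclideanSpace.proj i : E3 →L[ℝ] ℝ).hasFDerivAt (x := v x)).comp x hv.hasFDerivAt
  have h' : HasFDerivAt (fun y => v y i) ((EuclideanSpace.proj i : E3 →L[ℝ] ℝ) ∘L fderiv ℝ v x) x :=
    h
  rw [h'.fderiv]
  rfl

/-- A compactly supported gradient integrates to zero against a solenoidal field. Both need only be
regular on the support of the potential. -/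
theorem integral_fderiv_apply_eq_zero {ψ : E3 → ℝ} {v : E3 → E3} (hc : HasCompactSupport ψ)
    (hψ : ∀ x ∈ tsupport ψ, ContDiffAt ℝ 1 ψ x) (hv : ∀ x ∈ tsupport ψ, ContDiffAt ℝ 1 v x)
    (hdiv : ∀ x ∈ tsupport ψ, divergence v x = 0) :
    ∫ x, fderiv ℝ ψ x (v x) = 0 := by
  have hψd : ∀ x, DifferentiableAt ℝ ψ x := fun x => by
    by_cases hx : x ∈ tsupport ψ
    · exact (hψ x hx).differentiableAt one_ne_zero
    · exact (HasFDerivAt.of_notMem_tsupport ℝ hx).differentiableAt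
  have hψc : Continuous ψ := continuous_iff_continuousAt.2 fun x => (hψd x).continuousAt
  have hcoord : ∀ i, ∀ x ∈ tsupport ψ, ContinuousAt (fun y => v y i) x := fun i x hx =>
    (EuclideanSpace.proj i : E3 →L[ℝ] ℝ).continuous.continuousAt.comp (hv x hx).continuousAt
  have hvd : ∀ i, ∀ x ∈ tsupport ψ, DifferentiableAt ℝ (fun y => v y i) x := fun i x hx =>
    (EuclideanSpace.proj i : E3 →L[ℝ] ℝ).differentiableAt.comp x
      ((hv x hx).differentiableAt one_ne_zero)
  have hint1 : ∀ i, Integrable fun x => fderiv ℝ ψ x (EuclideanSpace.single i 1) * v x i := by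
    intro i
    refine Continuous.integrable_of_hasCompactSupport (continuous_of_tsupport fun x hx => ?_)
      (HasCompactSupport.intro hc fun x hx => by simp [fderiv_of_notMem_tsupport ℝ hx])
    have hx' : x ∈ tsupport ψ := by
      refine closure_minimal (fun y hy => ?_) (isClosed_tsupport ψ) hx
      by_contra hy'
      exact hy (by simp [fderiv_of_notMem_tsupport ℝ hy'])
    exact (((hψ x hx').continuousAt_fderiv one_ne_zero).clm_apply continuousAt_const).mul
      (hcoord i x hx')
  have hint2 : ∀ i, Integrable fun x => ψ x * fderiv ℝ v x (EuclideanSpace.single i 1) i := by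
    intro i
    refine Continuous.integrable_of_hasCompactSupport (continuous_of_tsupport fun x hx => ?_)
      (HasCompactSupport.intro hc fun x hx => by simp [image_eq_zero_of_notMem_tsupport hx])
    have hx' : x ∈ tsupport ψ := tsupport_mul_subset_left hx
    exact hψc.continuousAt.mul ((EuclideanSpace.proj i : E3 →L[ℝ] ℝ).continuous.continuousAt.comp
      (((hv x hx').continuousAt_fderiv one_ne_zero).clm_apply continuousAt_const))
  have hint3 : ∀ i, Integrable fun x => ψ x * v x i := by
    intro i
    refine Continuous.integrable_of_hasCompactSupport (continuous_of_tsupport fun x hx => ?_)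
      (HasCompactSupport.intro hc fun x hx => by simp [image_eq_zero_of_notMem_tsupport hx])
    have hx' : x ∈ tsupport ψ := tsupport_mul_subset_left hx
    exact hψc.continuousAt.mul (hcoord i x hx')
  have hcongr : ∀ i x, ψ x * fderiv ℝ (fun y => v y i) x (EuclideanSpace.single i 1)
      = ψ x * fderiv ℝ v x (EuclideanSpace.single i 1) i := by
    intro i x
    by_cases hx : x ∈ tsupport ψ
    · rw [fderiv_coord ((hv x hx).differentiableAt one_ne_zero)]
    · simp [image_eq_zero_of_notMem_tsupport hx]
  have hparts : ∀ i, ∫ x, fderiv ℝ ψ x (EuclideanSpace.single i 1) * v x i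
      = -∫ x, ψ x * fderiv ℝ v x (EuclideanSpace.single i 1) i := by
    intro i
    have h := integral_mul_fderiv_eq_neg_fderiv_mul_of_integrable (μ := (volume : Measure E3))
      (f := ψ) (g := fun y => v y i) (v := EuclideanSpace.single i 1) (hint1 i)
      ((hint2 i).congr (ae_of_all _ fun x => (hcongr i x).symm)) (hint3 i)
      (fun x _ => hψd x) (hvd i)
    rw [integral_congr_ae (ae_of_all _ (hcongr i))] at h
    linarith
  simp_rw [fderiv_apply_eq_sum ψ _ (v _)]
  rw [integral_finsetSum _ fun i _ => hint1 i]
  simp_rw [hparts]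
  rw [Finset.sum_neg_distrib, ← integral_finsetSum _ fun i _ => hint2 i]
  simp_rw [← Finset.mul_sum]
  rw [neg_eq_zero, integral_eq_zero_of_ae]
  refine ae_of_all _ fun x => ?_
  by_cases hx : x ∈ tsupport ψ
  · have h := hdiv x hx
    simp only [divergence, partialDeriv] at h
    simp [h]
  · simp [image_eq_zero_of_notMem_tsupport hx]

/-- Gradients integrate to zero against solenoidal fields on the whole space, under integrability
hypotheses that make the error of a cut-off at radius `R` vanish as `R → ∞`. -/
theorem integral_fderiv_apply_eq_zero_of_integrable {φ : E3 → ℝ} {v : E3 → E3}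
    (hφ : ContDiff ℝ 1 φ) (hv : ContDiff ℝ 1 v) (hdiv : ∀ x, divergence v x = 0)
    (h1 : Integrable fun x => fderiv ℝ φ x (v x))
    (h2 : Integrable fun x => |φ x| * ‖v x‖ / (1 + ‖x‖)) :
    ∫ x, fderiv ℝ φ x (v x) = 0 := by
  let χ : ContDiffBump (0 : E3) := ⟨1, 2, one_pos, one_lt_two⟩
  have hχ1 : ContDiff ℝ 1 χ := χ.contDiff
  have hχd : ∀ x, DifferentiableAt ℝ χ x := fun x => hχ1.differentiable one_ne_zero x
  obtain ⟨C, hC⟩ : ∃ C, ∀ y, ‖fderiv ℝ χ y‖ * (1 + ‖y‖) ≤ C := by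
    have hcs : HasCompactSupport fun y => ‖fderiv ℝ χ y‖ * (1 + ‖y‖) :=
      (χ.hasCompactSupport.fderiv ℝ).norm.mul_right
    have hcont : Continuous fun y : E3 => ‖fderiv ℝ χ y‖ * (1 + ‖y‖) :=
      (hχ1.continuous_fderiv one_ne_zero).norm.mul (by fun_prop)
    obtain ⟨C, hC⟩ := hcont.bounded_above_of_compact_support hcs
    exact ⟨C, fun y => (le_abs_self _).trans (hC y)⟩
  have hC0 : 0 ≤ C := (by positivity : 0 ≤ ‖fderiv ℝ χ (0 : E3)‖ * (1 + ‖(0 : E3)‖)).trans (hC 0)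
  -- the cut-offs `χ (x / (n + 1))` have gradients of order `1 / (1 + |x|)`, uniformly in `n`
  let c : ℕ → ℝ := fun n => ((n : ℝ) + 1)⁻¹
  have hc : ∀ n, 0 < c n := fun n => by positivity
  let χn : ℕ → E3 → ℝ := fun n x => χ (c n • x)
  have hχn : ∀ n, ContDiff ℝ 1 (χn n) := fun n => hχ1.comp (contDiff_const_smul (c n))
  have hdχ : ∀ n x, ‖fderiv ℝ (χn n) x‖ ≤ C / ((n : ℝ) + 1 + ‖x‖) := by
    intro n x
    have h : HasFDerivAt (χn n) ((fderiv ℝ χ (c n • x)) ∘L (c n • ContinuousLinearMap.id ℝ E3)) x :=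
      (hχd _).hasFDerivAt.comp x ((hasFDerivAt_id x).const_smul (c n))
    have hn : (0 : ℝ) < (n : ℝ) + 1 := by positivity
    rw [h.fderiv, le_div_iff₀ (by positivity)]
    have hle : ‖(fderiv ℝ χ (c n • x)) ∘L (c n • ContinuousLinearMap.id ℝ E3)‖
        ≤ ‖fderiv ℝ χ (c n • x)‖ * c n := by
      simp only [ContinuousLinearMap.comp_smul, ContinuousLinearMap.comp_id, norm_smul,
        Real.norm_eq_abs, abs_of_pos (hc n)]
      exact (mul_comm _ _).le
    refine (mul_le_mul_of_nonneg_right hle (by positivity)).trans (le_of_eq_of_le ?_ (hC (c n • x)))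
    rw [norm_smul, Real.norm_eq_abs, abs_of_pos (hc n)]
    simp only [c]
    field_simp
  have hzero : ∀ n, ∫ x, fderiv ℝ (fun y => χn n y * φ y) x (v x) = 0 := by
    intro n
    refine integral_fderiv_apply_eq_zero ?_ (fun x _ => ((hχn n).mul hφ).contDiffAt)
      (fun x _ => hv.contDiffAt) fun x _ => hdiv x
    refine HasCompactSupport.mul_right ?_
    exact χ.hasCompactSupport.comp_homeomorph (Homeomorph.smulOfNeZero (c n) (hc n).ne')
  have hform : ∀ n x, fderiv ℝ (fun y => χn n y * φ y) x (v x)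
      = χn n x * fderiv ℝ φ x (v x) + φ x * fderiv ℝ (χn n) x (v x) := by
    intro n x
    rw [fderiv_fun_mul ((hχn n).differentiable one_ne_zero x) (hφ.differentiable one_ne_zero x)]
    simp
  have hlim : Tendsto (fun n => ∫ x, fderiv ℝ (fun y => χn n y * φ y) x (v x)) atTop
      (𝓝 (∫ x, fderiv ℝ φ x (v x))) := by
    refine tendsto_integral_of_dominated_convergence
      (fun x => |fderiv ℝ φ x (v x)| + C * (|φ x| * ‖v x‖ / (1 + ‖x‖))) (fun n => ?_)
      (h1.abs.add (h2.const_mul C)) (fun n => ae_of_all _ fun x => ?_) (ae_of_all _ fun x => ?_)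
    · exact (continuous_fderiv_apply_of_tsupport (fun x _ => ((hχn n).mul hφ).contDiffAt)
        fun x _ => hv.continuous.continuousAt).aestronglyMeasurable
    · rw [hform]
      refine (norm_add_le _ _).trans (add_le_add ?_ ?_)
      · rw [norm_mul, Real.norm_eq_abs, Real.norm_eq_abs, abs_of_nonneg χ.nonneg]
        exact mul_le_of_le_one_left (abs_nonneg _) χ.le_one
      · rw [norm_mul, Real.norm_eq_abs]
        have h3 : ‖fderiv ℝ (χn n) x (v x)‖ ≤ C / (1 + ‖x‖) * ‖v x‖ := by
          refine (ContinuousLinearMap.le_opNorm _ _).trans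
            (mul_le_mul_of_nonneg_right ((hdχ n x).trans ?_) (norm_nonneg _))
          gcongr
          linarith [(Nat.cast_nonneg n : (0 : ℝ) ≤ n)]
        calc |φ x| * ‖fderiv ℝ (χn n) x (v x)‖ ≤ |φ x| * (C / (1 + ‖x‖) * ‖v x‖) := by gcongr
          _ = _ := by ring
    · have hcn : Tendsto c atTop (𝓝 0) := tendsto_inv_atTop_zero.comp
        (tendsto_atTop_add_const_right _ _ tendsto_natCast_atTop_atTop)
      have hχlim : Tendsto (fun n => χn n x) atTop (𝓝 1) := by
        have h3 : Tendsto (fun n => c n • x) atTop (𝓝 0) := by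
          simpa using hcn.smul_const x
        have h4 := (χ.continuous.tendsto 0).comp h3
        rwa [χ.one_of_mem_closedBall (Metric.mem_closedBall_self χ.rIn_pos.le)] at h4
      have hdlim : Tendsto (fun n => fderiv ℝ (χn n) x (v x)) atTop (𝓝 0) := by
        refine squeeze_zero_norm (fun n => ?_) (a := fun n : ℕ => C * c n * ‖v x‖) ?_
        · refine (ContinuousLinearMap.le_opNorm _ _).trans
            (mul_le_mul_of_nonneg_right ((hdχ n x).trans ?_) (norm_nonneg _))
          simp only [c, ← div_eq_mul_inv]
          exact div_le_div_of_nonneg_left hC0 (by positivity)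
            (le_add_of_nonneg_right (norm_nonneg x))
        · simpa using (hcn.const_mul C).mul_const ‖v x‖
      simp_rw [hform]
      simpa using (hχlim.mul_const (fderiv ℝ φ x (v x))).add (hdlim.const_mul (φ x))
  simp_rw [hzero] at hlim
  exact tendsto_nhds_unique hlim tendsto_const_nhds

/-- The increment `Q (x + h) - Q x` is the average of `∇Q · h` over the segment from `x` to `x + h`,
so it is square integrable as soon as the gradient `F = ∇Q` is. -/
lemma integrable_translate_sub_mul {F v : E3 → E3} {Q : E3 → ℝ} (hF : Continuous F)
    (hv : Continuous v) (hF2 : Integrable fun x => ‖F x‖ ^ 2) (hv2 : Integrable fun x => ‖v x‖ ^ 2)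
    (hQ : ∀ x, HasFDerivAt Q (innerSL ℝ (F x)) x) (h : E3) :
    Integrable fun x => |Q (x + h) - Q x| * ‖v x‖ := by
  have hQc : Continuous Q := continuous_iff_continuousAt.2 fun x => (hQ x).continuousAt
  have hprod : Integrable (fun p : E3 × ℝ => ‖F (p.1 + p.2 • h)‖ ^ 2)
      ((volume : Measure E3).prod (volume.restrict (Ioc (0 : ℝ) 1))) := by
    have hcont : Continuous fun p : E3 × ℝ => ‖F (p.1 + p.2 • h)‖ ^ 2 := by fun_prop
    refine (integrable_prod_iff' hcont.aestronglyMeasurable).2 ⟨ae_of_all _ fun s => ?_, ?_⟩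
    · exact hF2.comp_add_right (s • h)
    · have hconst : ∀ s : ℝ, ∫ x, ‖‖F (x + s • h)‖ ^ 2‖ = ∫ x, ‖F x‖ ^ 2 := fun s => by
        simp only [norm_pow, norm_norm]
        exact integral_add_right_eq_self (μ := (volume : Measure E3)) (fun x => ‖F x‖ ^ 2) (s • h)
      simp only [hconst]
      exact integrable_const _
  have hg := hprod.integral_prod_left
  refine Integrable.mono' ((hg.const_mul (‖h‖ ^ 2)).add hv2 |>.const_mul (1 / 2))
    (by fun_prop) (ae_of_all _ fun x => ?_)
  have hline : ∀ s : ℝ, HasDerivAt (fun s : ℝ => Q (x + s • h)) (inner ℝ (F (x + s • h)) h) s := by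
    intro s
    have h1 : HasDerivAt (fun s : ℝ => x + s • h) h s := by
      simpa using ((hasDerivAt_id s).smul_const h).const_add x
    exact (hQ _).comp_hasDerivAt s h1
  have hcF : Continuous fun s : ℝ => F (x + s • h) := by fun_prop
  have hftc : Q (x + h) - Q x = ∫ s in (0 : ℝ)..1, inner ℝ (F (x + s • h)) h := by
    rw [intervalIntegral.integral_eq_sub_of_hasDerivAt (fun s _ => hline s)
      (Continuous.intervalIntegrable (by fun_prop) _ _)]
    simp
  have hle : |Q (x + h) - Q x| ≤ ∫ s in (0 : ℝ)..1, ‖F (x + s • h)‖ * ‖h‖ := by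
    rw [hftc]
    refine (intervalIntegral.abs_integral_le_integral_abs zero_le_one).trans
      (intervalIntegral.integral_mono_on zero_le_one
        (Continuous.intervalIntegrable (by fun_prop) _ _)
        (Continuous.intervalIntegrable (by fun_prop) _ _) fun s _ => abs_real_inner_le_norm _ _)
  rw [Real.norm_eq_abs, abs_of_nonneg (by positivity)]
  calc |Q (x + h) - Q x| * ‖v x‖
      ≤ (∫ s in (0 : ℝ)..1, ‖F (x + s • h)‖ * ‖h‖) * ‖v x‖ := by gcongr
    _ = ∫ s in (0 : ℝ)..1, ‖F (x + s • h)‖ * ‖h‖ * ‖v x‖ :=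
      (intervalIntegral.integral_mul_const _ _).symm
    _ ≤ ∫ s in (0 : ℝ)..1, 1 / 2 * (‖h‖ ^ 2 * ‖F (x + s • h)‖ ^ 2 + ‖v x‖ ^ 2) := by
      refine intervalIntegral.integral_mono_on zero_le_one
        (Continuous.intervalIntegrable (by fun_prop) _ _)
        (Continuous.intervalIntegrable (by fun_prop) _ _) fun s _ => ?_
      nlinarith [sq_nonneg (‖F (x + s • h)‖ * ‖h‖ - ‖v x‖)]
    _ = 1 / 2 * (‖h‖ ^ 2 * (∫ s in Ioc (0 : ℝ) 1, ‖F (x + s • h)‖ ^ 2) + ‖v x‖ ^ 2) := by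
      rw [intervalIntegral.integral_const_mul, intervalIntegral.integral_add
        (Continuous.intervalIntegrable (by fun_prop) _ _)
        (Continuous.intervalIntegrable (by fun_prop) _ _), intervalIntegral.integral_const_mul,
        intervalIntegral.integral_of_le zero_le_one]
      simp

lemma integrable_inner_of_sq {α : Type*} [MeasurableSpace α] {μ : Measure α} {F G : α → E3}
    (hF : AEStronglyMeasurable F μ) (hG : AEStronglyMeasurable G μ)
    (hF2 : Integrable (fun x => ‖F x‖ ^ 2) μ) (hG2 : Integrable (fun x => ‖G x‖ ^ 2) μ) :
    Integrable (fun x => inner ℝ (F x) (G x)) μ := by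
  refine Integrable.mono' (hF2.add hG2) (hF.inner hG) (ae_of_all _ fun x => ?_)
  have h := norm_inner_le_norm (𝕜 := ℝ) (F x) (G x)
  simp only [Pi.add_apply]
  nlinarith [sq_nonneg (‖F x‖ - ‖G x‖), sq_nonneg (‖F x‖ + ‖G x‖)]

/-- The correlation of two square integrable fields decays along translations to infinity. -/
lemma eq_zero_of_integral_inner_translate_eq {F v : E3 → E3} (hF : Continuous F)
    (hv : Continuous v) (hF2 : Integrable fun x => ‖F x‖ ^ 2)
    (hv2 : Integrable fun x => ‖v x‖ ^ 2) {c : ℝ}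
    (hc : ∀ h : E3, ∫ x, inner ℝ (F (x + h)) (v x) = c) : c = 0 := by
  have tail : ∀ G : E3 → E3, Continuous G → Integrable (fun x => ‖G x‖ ^ 2) →
      Tendsto (fun n : ℕ => ∫ x in {x | (n : ℝ) < ‖x‖}, ‖G x‖ ^ 2) atTop (𝓝 0) := by
    intro G _ hG2
    have h := tendsto_setIntegral_of_antitone (μ := (volume : Measure E3))
      (f := fun x => ‖G x‖ ^ 2) (s := fun n : ℕ => {x : E3 | (n : ℝ) < ‖x‖})
      (fun n => measurableSet_lt measurable_const measurable_norm)
      (fun m n hmn x hx => lt_of_le_of_lt (Nat.cast_le (α := ℝ).2 hmn) (show (n : ℝ) < ‖x‖ from hx))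
      ⟨0, hG2.integrableOn⟩
    have hempty : ⋂ n : ℕ, {x : E3 | (n : ℝ) < ‖x‖} = ∅ := by
      refine eq_empty_of_forall_notMem fun x hx => ?_
      obtain ⟨n, hn⟩ := exists_nat_gt ‖x‖
      exact lt_asymm hn (mem_iInter.1 hx n)
    rwa [hempty, setIntegral_empty] at h
  let e : E3 := EuclideanSpace.single 0 1
  have he : ‖e‖ = 1 := by simp [e]
  set A := ∫ x, ‖F x‖ ^ 2
  set B := ∫ x, ‖v x‖ ^ 2
  -- `ab ≤ δa² + b²/δ`, with the large weight on a factor taken outside the ball of radius `n`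
  have key : ∀ δ : ℝ, 0 < δ → |c| ≤ δ * (A + B) := by
    intro δ hδ
    have hn : ∀ n : ℕ, |c| ≤ δ * (A + B) + δ⁻¹ * ((∫ x in {x | (n : ℝ) < ‖x‖}, ‖F x‖ ^ 2)
        + ∫ x in {x | (n : ℝ) < ‖x‖}, ‖v x‖ ^ 2) := by
      intro n
      let S : Set E3 := {x | (n : ℝ) < ‖x‖}
      have hS : MeasurableSet S := measurableSet_lt measurable_const measurable_norm
      -- a shift so long that `x` and `x + h` are never both in the ball of radius `n`
      let h : E3 := (3 * (n + 1) : ℝ) • e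
      have hh : ‖h‖ = 3 * (n + 1) := by
        simp only [h, norm_smul, he, Real.norm_eq_abs, mul_one]
        exact abs_of_nonneg (by positivity)
      have i1 : Integrable fun x => ‖F (x + h)‖ ^ 2 := hF2.comp_add_right h
      have i2 : Integrable fun x => S.indicator (fun x => ‖F x‖ ^ 2) (x + h) :=
        (hF2.indicator hS).comp_add_right h
      have i3 : Integrable fun x => S.indicator (fun x => ‖v x‖ ^ 2) x := hv2.indicator hS
      have hpt : ∀ x, ‖inner ℝ (F (x + h)) (v x)‖ ≤ δ * (‖F (x + h)‖ ^ 2 + ‖v x‖ ^ 2)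
          + δ⁻¹ * (S.indicator (fun x => ‖F x‖ ^ 2) (x + h)
            + S.indicator (fun x => ‖v x‖ ^ 2) x) := by
        intro x
        have h0 : ∀ a b : ℝ, a * b ≤ δ * a ^ 2 + δ⁻¹ * b ^ 2 := by
          intro a b
          have : δ * a ^ 2 + δ⁻¹ * b ^ 2 - a * b
              = δ * (a - δ⁻¹ * b / 2) ^ 2 + 3 / 4 * (δ⁻¹ * b ^ 2) := by
            field_simp
            ring
          have : 0 ≤ δ * (a - δ⁻¹ * b / 2) ^ 2 + 3 / 4 * (δ⁻¹ * b ^ 2) := by positivity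
          linarith
        have hi1 : 0 ≤ S.indicator (fun x => ‖F x‖ ^ 2) (x + h) :=
          indicator_nonneg (fun _ _ => by positivity) _
        have hi2 : 0 ≤ S.indicator (fun x => ‖v x‖ ^ 2) x :=
          indicator_nonneg (fun _ _ => by positivity) _
        have hδ' : 0 < δ⁻¹ := inv_pos.2 hδ
        refine (norm_inner_le_norm _ _).trans ?_
        by_cases hx : x ∈ S
        · have h1 := h0 ‖F (x + h)‖ ‖v x‖
          rw [indicator_of_mem hx]
          nlinarith [mul_nonneg hδ'.le hi1, mul_nonneg hδ.le (sq_nonneg ‖v x‖)]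
        · have hx' : x + h ∈ S := by
            have h1 : ‖x‖ ≤ n := not_lt.1 hx
            have h2 : ‖h‖ ≤ ‖x + h‖ + ‖x‖ := by
              simpa using norm_sub_le (x + h) x
            change (n : ℝ) < ‖x + h‖
            linarith [(Nat.cast_nonneg n : (0 : ℝ) ≤ n)]
          have h1 := h0 ‖v x‖ ‖F (x + h)‖
          rw [indicator_of_mem hx']
          nlinarith [mul_nonneg hδ'.le hi2, mul_nonneg hδ.le (sq_nonneg ‖F (x + h)‖)]
      rw [← hc h, ← Real.norm_eq_abs]
      refine (norm_integral_le_of_norm_le (((i1.add hv2).const_mul δ).add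
        ((i2.add i3).const_mul δ⁻¹)) (ae_of_all _ hpt)).trans (le_of_eq ?_)
      have i4 : Integrable fun x => δ * (‖F (x + h)‖ ^ 2 + ‖v x‖ ^ 2) := (i1.add hv2).const_mul δ
      have i5 : Integrable fun x => δ⁻¹ * (S.indicator (fun x => ‖F x‖ ^ 2) (x + h)
          + S.indicator (fun x => ‖v x‖ ^ 2) x) := (i2.add i3).const_mul δ⁻¹
      simp only [Pi.add_apply]
      rw [integral_add i4 i5, integral_const_mul, integral_const_mul, integral_add i2 i3,
        integral_add i1 hv2, integral_add_right_eq_self (fun x => ‖F x‖ ^ 2) h,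
        integral_add_right_eq_self (S.indicator fun x => ‖F x‖ ^ 2) h,
        integral_indicator hS, integral_indicator hS]
    have hlim := (((tail F hF hF2).add (tail v hv hv2)).const_mul δ⁻¹).const_add (δ * (A + B))
    rw [add_zero, mul_zero, add_zero] at hlim
    exact ge_of_tendsto' hlim hn
  have hlim : Tendsto (fun δ : ℝ => δ * (A + B)) (𝓝[>] 0) (𝓝 0) := by
    have h : Tendsto (fun δ : ℝ => δ * (A + B)) (𝓝 0) (𝓝 (0 * (A + B))) :=
      tendsto_id.mul_const _
    rw [zero_mul] at h
    exact h.mono_left nhdsWithin_le_nhds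
  have h0 : |c| ≤ 0 := ge_of_tendsto hlim (eventually_mem_nhdsWithin.mono fun δ hδ => key δ hδ)
  exact abs_eq_zero.1 (le_antisymm h0 (abs_nonneg c))

/-- A square integrable curl-free field is orthogonal to every square integrable solenoidal field.
The difference of the curl-free field and a translate of it has a square integrable potential, so
the correlation does not change under translations; and it decays. -/
lemma integral_inner_eq_zero_of_curl_eq_zero {F v : E3 → E3} (hF : Differentiable ℝ F)
    (hcurl : ∀ x, curl F x = 0) (hv : ContDiff ℝ 1 v) (hdiv : ∀ x, divergence v x = 0)
    (hF2 : Integrable fun x => ‖F x‖ ^ 2) (hv2 : Integrable fun x => ‖v x‖ ^ 2) :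
    ∫ x, inner ℝ (F x) (v x) = 0 := by
  have hω : ∀ x, HasFDerivAt (fun y => innerSL ℝ (F y)) (innerSL ℝ ∘L fderiv ℝ F x) x := fun x =>
    ((innerSL ℝ).hasFDerivAt (x := F x)).comp x (hF x).hasFDerivAt
  obtain ⟨Q, hQ⟩ := convex_univ.exists_forall_hasFDerivAt_of_fderiv_symmetric isOpen_univ
    (ω := fun y => innerSL ℝ (F y)) (fun x _ => (hω x).differentiableAt.differentiableWithinAt)
    fun x _ a b => by
      rw [(hω x).fderiv]
      exact inner_fderiv_comm_of_curl_eq_zero (hcurl x) a b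
  have hQ' : ∀ x, HasFDerivAt Q (innerSL ℝ (F x)) x := fun x => hQ x (mem_univ x)
  have hint : ∀ h : E3, Integrable fun x => inner ℝ (F (x + h)) (v x) := fun h =>
    integrable_inner_of_sq (hF.continuous.comp (continuous_add_const h)).aestronglyMeasurable
      hv.continuous.aestronglyMeasurable (hF2.comp_add_right h) hv2
  have hint0 : Integrable fun x => inner ℝ (F x) (v x) := by simpa using hint 0
  refine eq_zero_of_integral_inner_translate_eq hF.continuous hv.continuous hF2 hv2 fun h => ?_
  have hd : ∀ x, HasFDerivAt (fun x => Q (x + h) - Q x)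
      (innerSL ℝ (F (x + h)) - innerSL ℝ (F x)) x := fun x =>
    ((hasFDerivAt_comp_add_right h).2 (hQ' (x + h))).sub (hQ' x)
  have hd' : ∀ x, fderiv ℝ (fun x => Q (x + h) - Q x) x (v x)
      = inner ℝ (F (x + h)) (v x) - inner ℝ (F x) (v x) := fun x => by
    rw [(hd x).fderiv]
    rfl
  have hsm : ContDiff ℝ 1 fun x => Q (x + h) - Q x := by
    rw [contDiff_one_iff_fderiv]
    refine ⟨fun x => (hd x).differentiableAt, ?_⟩
    rw [funext fun x => (hd x).fderiv]
    have := hF.continuous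
    fun_prop
  have hzero := integral_fderiv_apply_eq_zero_of_integrable hsm hv hdiv
    (((hint h).sub hint0).congr (ae_of_all _ fun x => (hd' x).symm)) ?_
  · simp_rw [hd'] at hzero
    rw [integral_sub (hint h) hint0, sub_eq_zero] at hzero
    exact hzero
  · have hb := integrable_translate_sub_mul hF.continuous hv.continuous hF2 hv2 hQ' h
    refine hb.mono' ?_ (ae_of_all _ fun x => ?_)
    · have h1 := hsm.continuous
      have h2 := hv.continuous
      refine Continuous.aestronglyMeasurable (Continuous.div (by fun_prop) (by fun_prop)
        fun x => ?_)
      positivity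
    · rw [Real.norm_eq_abs, abs_of_nonneg (by positivity)]
      exact div_le_self (by positivity) (by linarith [norm_nonneg x])

/-! ### Tangential solenoidal fields on bounded `C²` domains -/

lemma integrableOn_of_continuousOn_of_abs_le {Ω : Set E3} (hΩ : IsOpen Ω)
    (hb : Bornology.IsBounded Ω) {f : E3 → ℝ} (hf : ContinuousOn f Ω) {C : ℝ}
    (hC : ∀ x ∈ Ω, |f x| ≤ C) : IntegrableOn f Ω :=
  ⟨hf.aestronglyMeasurable hΩ.measurableSet, HasFiniteIntegral.restrict_of_bounded C
    hb.measure_lt_top ((ae_restrict_iff' hΩ.measurableSet).2 (ae_of_all _ hC))⟩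

lemma continuousOn_of_eq_zero_of_notMem {Ω B S : Set E3} {f : E3 → ℝ}
    (hS : IsClosed S) (hB : IsOpen B) (hSB : S ⊆ B) (hf : ContinuousOn f (Ω ∩ B))
    (h0 : ∀ x, x ∉ S → f x = 0) : ContinuousOn f Ω := by
  intro x hx
  by_cases hxS : x ∈ S
  · exact (hf x ⟨hx, hSB hxS⟩).mono_of_mem_nhdsWithin
      (inter_mem_nhdsWithin Ω (hB.mem_nhds (hSB hxS)))
  · have h : f =ᶠ[𝓝 x] fun _ => 0 := by
      filter_upwards [hS.isOpen_compl.mem_nhds hxS] with y hy using h0 y hy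
    exact (continuousAt_const.congr h.symm).continuousWithinAt

/-- A smooth monotone step, `0` up to `1` and `1` from `2` on. -/
noncomputable def smoothStep (s : ℝ) : ℝ := Real.smoothTransition (s - 1)

lemma contDiff_smoothStep : ContDiff ℝ 1 smoothStep :=
  (Real.smoothTransition.contDiff (n := 1)).comp (contDiff_id.sub contDiff_const)

lemma deriv_smoothStep_nonneg (s : ℝ) : 0 ≤ deriv smoothStep s :=
  (Real.smoothTransition.monotone.comp fun _ _ h => sub_le_sub_right h 1).deriv_nonneg

lemma abs_smoothStep_le (s : ℝ) : |smoothStep s| ≤ 1 := by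
  rw [smoothStep, abs_of_nonneg (Real.smoothTransition.nonneg _)]
  exact Real.smoothTransition.le_one _

lemma smoothStep_eq_zero {s : ℝ} (hs : s ≤ 1) : smoothStep s = 0 :=
  Real.smoothTransition.zero_of_nonpos (by linarith)

lemma smoothStep_eq_one {s : ℝ} (hs : 2 ≤ s) : smoothStep s = 1 :=
  Real.smoothTransition.one_of_one_le (by linarith)

lemma deriv_smoothStep_eq_zero {s : ℝ} (hs : 2 < s) : deriv smoothStep s = 0 := by
  have h : smoothStep =ᶠ[𝓝 s] fun _ => 1 := by
    filter_upwards [lt_mem_nhds hs] with y hy using smoothStep_eq_one hy.le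
  rw [h.deriv_eq]
  simp

/-- The integral over `Ω` of the gradient of `θ g` against a solenoidal field, cut off at distance
of order `1 / m` from the part of the boundary near `p`, with the error term of the cut-off. -/
lemma setIntegral_cutoff {Ω U : Set E3} {p : E3} {ρ θ g : E3 → ℝ} {V : E3 → E3} {r m : ℝ}
    (hΩ : IsOpen Ω) (hρ : IsC2DefiningFunction Ω p U ρ) (hr : Metric.ball p r ⊆ U)
    (hθ : ContDiff ℝ 1 θ) (hθc : HasCompactSupport θ) (hθs : tsupport θ ⊆ Metric.ball p r)
    (hg : ContDiffOn ℝ 1 g Ω) (hV : ContDiffOn ℝ 1 V Ω) (hdiv : ∀ x ∈ Ω, divergence V x = 0)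
    (hm : 0 < m) :
    IntegrableOn (fun x => smoothStep (-(m * ρ x)) * fderiv ℝ (fun y => θ y * g y) x (V x)
      - θ x * g x * (m * deriv smoothStep (-(m * ρ x))) * fderiv ℝ ρ x (V x)) Ω ∧
    ∫ x in Ω, (smoothStep (-(m * ρ x)) * fderiv ℝ (fun y => θ y * g y) x (V x)
      - θ x * g x * (m * deriv smoothStep (-(m * ρ x))) * fderiv ℝ ρ x (V x)) = 0 := by
  set ψ : E3 → ℝ := fun x => θ x * g x * smoothStep (-(m * ρ x)) with hψ
  have hsub : tsupport ψ ⊆ Ω ∩ tsupport θ := by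
    have hρc : ContinuousOn ρ (tsupport θ) := hρ.contDiffOn.continuousOn.mono (hθs.trans hr)
    have hK : IsClosed (tsupport θ ∩ ρ ⁻¹' Iic (-m⁻¹)) :=
      hρc.preimage_isClosed_of_isClosed (isClosed_tsupport θ) isClosed_Iic
    have hle : tsupport ψ ⊆ tsupport θ ∩ ρ ⁻¹' Iic (-m⁻¹) := by
      refine closure_minimal (fun x hx => ?_) hK
      have hθx : θ x ≠ 0 := fun h => hx (by simp [hψ, h])
      refine ⟨subset_tsupport θ hθx, ?_⟩
      by_contra hlt
      refine hx ?_
      simp only [mem_preimage, mem_Iic, not_le] at hlt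
      have h1 : -(m * ρ x) ≤ 1 := by
        have h2 := mul_lt_mul_of_pos_left hlt hm
        rw [mul_neg, mul_inv_cancel₀ hm.ne'] at h2
        linarith
      simp [hψ, smoothStep_eq_zero h1]
    intro x hx
    obtain ⟨h1, h2⟩ := hle hx
    refine ⟨(hρ.mem_iff x (hr (hθs h1))).2 (lt_of_le_of_lt h2 ?_), h1⟩
    exact neg_neg_of_pos (inv_pos.2 hm)
  have hρat : ∀ x ∈ Metric.ball p r, ContDiffAt ℝ 1 ρ x := fun x hx =>
    (hρ.contDiffOn.contDiffAt (hρ.isOpen.mem_nhds (hr hx))).of_le one_le_two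
  have hgat : ∀ x ∈ Ω, ContDiffAt ℝ 1 g x := fun x hx => hg.contDiffAt (hΩ.mem_nhds hx)
  have hVat : ∀ x ∈ Ω, ContDiffAt ℝ 1 V x := fun x hx => hV.contDiffAt (hΩ.mem_nhds hx)
  have hψc : HasCompactSupport ψ := hθc.mul_right.mul_right
  have hψat : ∀ x ∈ tsupport ψ, ContDiffAt ℝ 1 ψ x := fun x hx =>
    (hθ.contDiffAt.mul (hgat x (hsub hx).1)).mul (contDiff_smoothStep.contDiffAt.comp x
      (contDiffAt_const.mul (hρat x (hθs (hsub hx).2))).neg)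
  have hform : ∀ x ∈ Ω, fderiv ℝ ψ x (V x)
      = smoothStep (-(m * ρ x)) * fderiv ℝ (fun y => θ y * g y) x (V x)
      - θ x * g x * (m * deriv smoothStep (-(m * ρ x))) * fderiv ℝ ρ x (V x) := by
    intro x hx
    by_cases hxθ : x ∈ tsupport θ
    · have h1 : HasFDerivAt (fun y => θ y * g y) (fderiv ℝ (fun y => θ y * g y) x) x :=
        ((hθ.contDiffAt.mul (hgat x hx)).differentiableAt one_ne_zero).hasFDerivAt
      have h2 : HasFDerivAt (fun y => -(m * ρ y)) (-(m • fderiv ℝ ρ x)) x :=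
        (((hρat x (hθs hxθ)).differentiableAt one_ne_zero).hasFDerivAt.const_mul m).neg
      have h3 : HasFDerivAt (fun y => smoothStep (-(m * ρ y)))
          (deriv smoothStep (-(m * ρ x)) • -(m • fderiv ℝ ρ x)) x :=
        ((contDiff_smoothStep.differentiable one_ne_zero _).hasDerivAt).comp_hasFDerivAt x h2
      have h4 : HasFDerivAt ψ _ x := h1.mul h3
      rw [h4.fderiv]
      simp
      ring
    · have hθ0 : θ =ᶠ[𝓝 x] 0 := notMem_tsupport_iff_eventuallyEq.1 hxθ
      have h1 : ψ =ᶠ[𝓝 x] fun _ => 0 := by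
        filter_upwards [hθ0] with y hy
        simp [hψ, hy]
      have h2 : (fun y => θ y * g y) =ᶠ[𝓝 x] fun _ => 0 := by
        filter_upwards [hθ0] with y hy
        simp [hy]
      rw [h1.fderiv_eq, h2.fderiv_eq, hθ0.self_of_nhds]
      simp
  have hint : Integrable fun x => fderiv ℝ ψ x (V x) :=
    (continuous_fderiv_apply_of_tsupport hψat
      fun x hx => (hVat x (hsub hx).1).continuousAt).integrable_of_hasCompactSupport
      (hasCompactSupport_fderiv_apply hψc V)
  refine ⟨hint.integrableOn.congr_fun hform hΩ.measurableSet, ?_⟩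
  rw [← setIntegral_congr_fun hΩ.measurableSet hform,
    setIntegral_eq_integral_of_forall_compl_eq_zero]
  · exact integral_fderiv_apply_eq_zero hψc hψat (fun x hx => hVat x (hsub hx).1)
      fun x hx => hdiv x (hsub hx).1
  · intro x hx
    rw [fderiv_of_notMem_tsupport ℝ fun h => hx (hsub h).1]
    simp

/-- The cut-off layers have bounded total weight: integrate the derivative of the cut-off by parts
along a direction `e` transversal to the boundary. -/
lemma setIntegral_layer_le {Ω U : Set E3} {p e : E3} {ρ θ : E3 → ℝ} {r c m : ℝ}
    (hΩ : IsOpen Ω) (hb : Bornology.IsBounded Ω)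
    (hρ : IsC2DefiningFunction Ω p U ρ) (hr : Metric.ball p r ⊆ U)
    (hc : 0 < c) (he : ∀ x ∈ Metric.ball p r, c ≤ fderiv ℝ ρ x e)
    (hθ : ContDiff ℝ 1 θ) (hθc : HasCompactSupport θ) (hθs : tsupport θ ⊆ Metric.ball p r)
    (hθ0 : ∀ x, 0 ≤ θ x) (hm : 0 < m) :
    IntegrableOn (fun x => θ x * (m * deriv smoothStep (-(m * ρ x)))) Ω ∧
    ∫ x in Ω, θ x * (m * deriv smoothStep (-(m * ρ x)))
      ≤ c⁻¹ * ∫ x in Ω, |fderiv ℝ θ x e| := by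
  have hdiv : ∀ x ∈ Ω, divergence (fun _ => e) x = 0 := fun x _ => by
    simp [divergence, partialDeriv]
  obtain ⟨h1, h2⟩ := setIntegral_cutoff (g := fun _ => 1) hΩ hρ hr hθ hθc hθs contDiffOn_const
    (contDiffOn_const (c := e)) hdiv hm
  simp only [mul_one] at h1 h2
  have hρc : ContinuousOn ρ (Ω ∩ Metric.ball p r) :=
    hρ.contDiffOn.continuousOn.mono (inter_subset_right.trans hr)
  have hdθ : Continuous fun x => fderiv ℝ θ x e :=
    (hθ.continuous_fderiv one_ne_zero).clm_apply continuous_const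
  obtain ⟨C, hC⟩ := hdθ.bounded_above_of_compact_support
    (hasCompactSupport_fderiv_apply hθc fun _ => e)
  have hstep : Continuous smoothStep := contDiff_smoothStep.continuous
  have hstep' : Continuous (deriv smoothStep) := contDiff_smoothStep.continuous_deriv le_rfl
  have hX : IntegrableOn (fun x => smoothStep (-(m * ρ x)) * fderiv ℝ θ x e) Ω := by
    refine integrableOn_of_continuousOn_of_abs_le hΩ hb (C := C) (continuousOn_of_eq_zero_of_notMem
      (isClosed_tsupport θ) Metric.isOpen_ball hθs
      ((hstep.comp_continuousOn (hρc.const_mul m).neg).mul hdθ.continuousOn) fun x hx => ?_)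
      fun x _ => ?_
    · simp [fderiv_of_notMem_tsupport ℝ hx]
    · rw [abs_mul]
      exact (mul_le_of_le_one_left (abs_nonneg _) (abs_smoothStep_le _)).trans (hC x)
  have hY : IntegrableOn
      (fun x => θ x * (m * deriv smoothStep (-(m * ρ x))) * fderiv ℝ ρ x e) Ω :=
    (hX.sub h1).congr_fun (fun x _ => by simp) hΩ.measurableSet
  have hcmp : ∀ x, θ x * (m * deriv smoothStep (-(m * ρ x)))
      ≤ c⁻¹ * (θ x * (m * deriv smoothStep (-(m * ρ x))) * fderiv ℝ ρ x e) := by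
    intro x
    by_cases hx : x ∈ tsupport θ
    · have h3 : 0 ≤ θ x * (m * deriv smoothStep (-(m * ρ x))) :=
        mul_nonneg (hθ0 x) (mul_nonneg hm.le (deriv_smoothStep_nonneg _))
      rw [inv_mul_eq_div, le_div_iff₀ hc]
      exact mul_le_mul_of_nonneg_left (he x (hθs hx)) h3
    · simp [image_eq_zero_of_notMem_tsupport hx]
  have hnn : ∀ x, 0 ≤ θ x * (m * deriv smoothStep (-(m * ρ x))) := fun x =>
    mul_nonneg (hθ0 x) (mul_nonneg hm.le (deriv_smoothStep_nonneg _))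
  have hI : IntegrableOn (fun x => θ x * (m * deriv smoothStep (-(m * ρ x)))) Ω := by
    refine Integrable.mono' (hY.const_mul c⁻¹) ?_ (ae_of_all _ fun x => ?_)
    · refine (continuousOn_of_eq_zero_of_notMem (isClosed_tsupport θ) Metric.isOpen_ball hθs
        (hθ.continuous.continuousOn.mul ((hstep'.comp_continuousOn
          (hρc.const_mul m).neg).const_mul m)) fun x hx => ?_).aestronglyMeasurable
        hΩ.measurableSet
      simp [image_eq_zero_of_notMem_tsupport hx]
    · rw [Real.norm_eq_abs, abs_of_nonneg (hnn x)]
      exact hcmp x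
  refine ⟨hI, ?_⟩
  calc ∫ x in Ω, θ x * (m * deriv smoothStep (-(m * ρ x)))
      ≤ ∫ x in Ω, c⁻¹ * (θ x * (m * deriv smoothStep (-(m * ρ x))) * fderiv ℝ ρ x e) :=
        integral_mono hI (hY.const_mul c⁻¹) hcmp
    _ = c⁻¹ * ∫ x in Ω, smoothStep (-(m * ρ x)) * fderiv ℝ θ x e := by
        rw [integral_const_mul]
        rw [integral_sub hX hY, sub_eq_zero] at h2
        rw [h2]
    _ ≤ c⁻¹ * ∫ x in Ω, |fderiv ℝ θ x e| := by
        refine mul_le_mul_of_nonneg_left (integral_mono hX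
          (hdθ.integrable_of_hasCompactSupport
            (hasCompactSupport_fderiv_apply hθc fun _ => e)).abs.integrableOn fun x => ?_)
          (inv_pos.2 hc).le
        refine (le_abs_self _).trans ?_
        rw [abs_mul]
        exact mul_le_of_le_one_left (abs_nonneg _) (abs_smoothStep_le _)

lemma IsC2DefiningFunction.nonpos_of_mem_closure {Ω U : Set E3} {p : E3} {ρ : E3 → ℝ}
    (hρ : IsC2DefiningFunction Ω p U ρ) {x : E3} (hx : x ∈ closure Ω) (hxU : x ∈ U) : ρ x ≤ 0 := by
  have hU : U ∈ 𝓝 x := hρ.isOpen.mem_nhds hxU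
  have h1 : ContinuousAt ρ x := hρ.contDiffOn.continuousOn.continuousAt hU
  by_contra hlt
  obtain ⟨y, ⟨hy1, hy2⟩, hyΩ⟩ := mem_closure_iff_nhds.1 hx _
    (inter_mem (h1.eventually (lt_mem_nhds (not_le.1 hlt))) hU)
  exact lt_asymm hy1 ((hρ.mem_iff y hy2).1 hyΩ)

lemma fderiv_apply_eq_inner_gradient (ρ : E3 → ℝ) (x y : E3) :
    fderiv ℝ ρ x y = inner ℝ (gradient ρ x) y := by
  simp [gradient]

/-- Near a boundary point, a defining function grows at a definite rate along its gradient. -/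
lemma IsC2DefiningFunction.exists_transversal {Ω U : Set E3} {p : E3} {ρ : E3 → ℝ}
    (hρ : IsC2DefiningFunction Ω p U ρ) : ∃ (r c : ℝ) (e : E3), 0 < r ∧ 0 < c ∧
      Metric.ball p r ⊆ U ∧ ∀ x ∈ Metric.ball p r, c ≤ fderiv ℝ ρ x e := by
  have hU : U ∈ 𝓝 p := hρ.isOpen.mem_nhds hρ.mem
  have hpos : 0 < fderiv ℝ ρ p (gradient ρ p) := by
    rw [fderiv_apply_eq_inner_gradient, real_inner_self_eq_norm_sq]
    have := norm_pos_iff.2 hρ.gradient_ne_zero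
    positivity
  have hcont : ContinuousAt (fun x => fderiv ℝ ρ x (gradient ρ p)) p :=
    ((hρ.contDiffOn.contDiffAt hU).continuousAt_fderiv two_ne_zero).clm_apply continuousAt_const
  obtain ⟨r, hr, hball⟩ := Metric.mem_nhds_iff.1
    (inter_mem hU (hcont.eventually (lt_mem_nhds (half_lt_self hpos))))
  exact ⟨r, _, _, hr, half_pos hpos, fun x hx => (hball hx).1, fun x hx => (hball hx).2.le⟩

/-- Near a point of a `C²` boundary, gradients of functions with bounded gradient integrate to zero
against tangential solenoidal fields. The error of the cut-off tends to zero because the normal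
component of the field is small in the layer, which has bounded total weight. -/
lemma setIntegral_fderiv_mul_eq_zero_near_frontier {Ω U : Set E3} {p e : E3} {ρ θ φ : E3 → ℝ}
    {v : E3 → E3} {r c C D : ℝ} (hΩ : IsOpen Ω) (hb : Bornology.IsBounded Ω)
    (hρ : IsC2DefiningFunction Ω p U ρ) (hr : Metric.ball p r ⊆ U)
    (hc : 0 < c) (he : ∀ x ∈ Metric.ball p r, c ≤ fderiv ℝ ρ x e)
    (hθ : ContDiff ℝ 1 θ) (hθc : HasCompactSupport θ) (hθs : tsupport θ ⊆ Metric.ball p r)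
    (hθ0 : ∀ x, 0 ≤ θ x)
    (hv : ContDiffOn ℝ 1 v Ω) (hdiv : ∀ x ∈ Ω, divergence v x = 0)
    (hvc : ContinuousOn v (closure Ω))
    (htan : ∀ q ∈ frontier Ω, ∀ n, IsOutwardUnitNormal Ω q n → inner ℝ (v q) n = 0)
    (hφ : ContDiffOn ℝ 1 φ Ω) (hφC : ∀ x ∈ Ω, |φ x| ≤ C)
    (hD : ∀ x ∈ Ω, |fderiv ℝ (fun y => θ y * φ y) x (v x)| ≤ D) :
    ∫ x in Ω, fderiv ℝ (fun y => θ y * φ y) x (v x) = 0 := by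
  rcases Ω.eq_empty_or_nonempty with rfl | ⟨x₀, hx₀⟩
  · simp
  have hC0 : 0 ≤ C := (abs_nonneg _).trans (hφC x₀ hx₀)
  have hcl : IsCompact (closure Ω) := hb.isCompact_closure
  have hρc : ContinuousOn ρ (Metric.ball p r) := hρ.contDiffOn.continuousOn.mono hr
  have hdρ : ContinuousOn (fderiv ℝ ρ) (Metric.ball p r) :=
    (hρ.contDiffOn.continuousOn_fderiv_of_isOpen hρ.isOpen one_le_two).mono hr
  -- the normal component of `v` is small near the boundary
  have hsmall : ∀ κ > 0, ∃ δ > 0, ∀ x ∈ tsupport θ ∩ closure Ω, -δ ≤ ρ x →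
      |fderiv ℝ ρ x (v x)| ≤ κ := by
    intro κ hκ
    set S := tsupport θ ∩ closure Ω
    have hSc : IsCompact S := hcl.inter_left (isClosed_tsupport θ)
    have hcont : ContinuousOn (fun x => |fderiv ℝ ρ x (v x)|) S :=
      ((hdρ.mono (inter_subset_left.trans hθs)).clm_apply (hvc.mono inter_subset_right)).abs
    have hA : IsCompact (S ∩ (fun x => |fderiv ℝ ρ x (v x)|) ⁻¹' Ici κ) :=
      hSc.of_isClosed_subset (hcont.preimage_isClosed_of_isClosed hSc.isClosed isClosed_Ici)
        inter_subset_left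
    rcases (S ∩ (fun x => |fderiv ℝ ρ x (v x)|) ⁻¹' Ici κ).eq_empty_or_nonempty with hem | hne
    · refine ⟨1, one_pos, fun x hx _ => ?_⟩
      by_contra hlt
      exact notMem_empty x (hem ▸ ⟨hx, (not_le.1 hlt).le⟩)
    · -- among the points with a large normal component, one maximizing `ρ` lies in the interior,
      -- since the normal component vanishes on the boundary
      obtain ⟨x₁, hx₁, hmax⟩ := hA.exists_isMaxOn hne
        (hρc.mono fun x hx => hθs hx.1.1)
      have hx₁b : x₁ ∈ Metric.ball p r := hθs hx₁.1.1
      have hneg : ρ x₁ < 0 := by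
        refine lt_of_le_of_ne (hρ.nonpos_of_mem_closure hx₁.1.2 (hr hx₁b)) fun h0 => ?_
        have hnot : x₁ ∉ Ω := fun h => ((hρ.mem_iff x₁ (hr hx₁b)).1 h).ne h0
        have hfr : x₁ ∈ frontier Ω := by
          rw [hΩ.frontier_eq]
          exact ⟨hx₁.1.2, hnot⟩
        have hgrad : gradient ρ x₁ ≠ 0 := by
          intro h
          have h1 := he x₁ hx₁b
          rw [fderiv_apply_eq_inner_gradient, h, inner_zero_left] at h1
          linarith
        have h1 := htan x₁ hfr _ ⟨U, ρ, ⟨hρ.isOpen, hr hx₁b, hρ.contDiffOn, hgrad, hρ.mem_iff⟩, rfl⟩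
        rw [inner_smul_right, mul_eq_zero] at h1
        have h2 : fderiv ℝ ρ x₁ (v x₁) = 0 := by
          rw [fderiv_apply_eq_inner_gradient, real_inner_comm]
          exact h1.resolve_left (inv_ne_zero (norm_ne_zero_iff.2 hgrad))
        have h3 : κ ≤ |fderiv ℝ ρ x₁ (v x₁)| := hx₁.2
        rw [h2, abs_zero] at h3
        linarith
      refine ⟨-ρ x₁ / 2, by linarith, fun x hx hle => ?_⟩
      by_contra hlt
      have h1 : ρ x ≤ ρ x₁ := hmax ⟨hx, (not_le.1 hlt).le⟩
      linarith
  set A := c⁻¹ * ∫ x in Ω, |fderiv ℝ θ x e|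
  have hdcont : ContinuousOn (fun x => fderiv ℝ (fun y => θ y * φ y) x (v x)) Ω :=
    ((hθ.contDiffOn.mul hφ).continuousOn_fderiv_of_isOpen hΩ le_rfl).clm_apply hv.continuousOn
  have hI : IntegrableOn (fun x => fderiv ℝ (fun y => θ y * φ y) x (v x)) Ω :=
    integrableOn_of_continuousOn_of_abs_le hΩ hb hdcont hD
  have hzero : ∀ x, x ∉ tsupport θ → fderiv ℝ (fun y => θ y * φ y) x = 0 := fun x hx =>
    fderiv_of_notMem_tsupport ℝ fun h => hx (tsupport_mul_subset_left h)
  set J : ℕ → E3 → ℝ := fun n x => smoothStep (-(((n : ℝ) + 1) * ρ x))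
    * fderiv ℝ (fun y => θ y * φ y) x (v x) with hJ
  have hJc : ∀ n, ContinuousOn (J n) Ω := fun n => by
    refine continuousOn_of_eq_zero_of_notMem (isClosed_tsupport θ) Metric.isOpen_ball hθs
      ((contDiff_smoothStep.continuous.comp_continuousOn
        ((hρc.mono inter_subset_right).const_mul _).neg).mul (hdcont.mono inter_subset_left))
      fun x hx => ?_
    simp [hJ, hzero x hx]
  have hJle : ∀ n x, |J n x| ≤ |fderiv ℝ (fun y => θ y * φ y) x (v x)| := fun n x => by
    rw [hJ, abs_mul]
    exact mul_le_of_le_one_left (abs_nonneg _) (abs_smoothStep_le _)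
  have hJi : ∀ n, IntegrableOn (J n) Ω := fun n =>
    integrableOn_of_continuousOn_of_abs_le hΩ hb (hJc n) fun x hx => (hJle n x).trans (hD x hx)
  have hlim : Tendsto (fun n => ∫ x in Ω, J n x) atTop
      (𝓝 (∫ x in Ω, fderiv ℝ (fun y => θ y * φ y) x (v x))) := by
    refine tendsto_integral_of_dominated_convergence _ (fun n => (hJi n).aestronglyMeasurable)
      hI.abs (fun n => ae_of_all _ fun x => hJle n x) ?_
    refine (ae_restrict_iff' hΩ.measurableSet).2 (ae_of_all _ fun x hx => ?_)
    by_cases hxθ : x ∈ tsupport θ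
    · have hneg : ρ x < 0 := (hρ.mem_iff x (hr (hθs hxθ))).1 hx
      obtain ⟨N, hN⟩ := exists_nat_gt (2 / -ρ x)
      refine tendsto_const_nhds.congr' (eventually_atTop.2 ⟨N, fun n hn => ?_⟩)
      have h1 : (N : ℝ) ≤ n := Nat.cast_le.2 hn
      rw [div_lt_iff₀ (neg_pos.2 hneg)] at hN
      rw [hJ]
      simp only
      rw [smoothStep_eq_one (by nlinarith), one_mul]
    · simp [hJ, hzero x hxθ]
  have hbound : ∀ κ > 0, ∀ᶠ n in atTop, |∫ x in Ω, J n x| ≤ C * κ * A := by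
    intro κ hκ
    obtain ⟨δ, hδ, hsm⟩ := hsmall κ hκ
    obtain ⟨N, hN⟩ := exists_nat_gt (2 / δ)
    filter_upwards [eventually_ge_atTop N] with n hn
    have hm : (0 : ℝ) < (n : ℝ) + 1 := by positivity
    have hnδ : 2 < ((n : ℝ) + 1) * δ := by
      have h1 : (N : ℝ) ≤ n := Nat.cast_le.2 hn
      rw [div_lt_iff₀ hδ] at hN
      nlinarith
    obtain ⟨h1, h2⟩ := setIntegral_cutoff hΩ hρ hr hθ hθc hθs hφ hv hdiv hm
    obtain ⟨h3, h4⟩ := setIntegral_layer_le hΩ hb hρ hr hc he hθ hθc hθs hθ0 hm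
    have hY : IntegrableOn (fun x => θ x * φ x * (((n : ℝ) + 1)
        * deriv smoothStep (-(((n : ℝ) + 1) * ρ x))) * fderiv ℝ ρ x (v x)) Ω :=
      ((hJi n).sub h1).congr_fun (fun x _ => by simp [hJ]) hΩ.measurableSet
    have h5 : ∫ x in Ω, J n x = ∫ x in Ω, θ x * φ x * (((n : ℝ) + 1)
        * deriv smoothStep (-(((n : ℝ) + 1) * ρ x))) * fderiv ℝ ρ x (v x) := by
      have h6 := integral_sub (hJi n) hY
      simp only [hJ] at h6
      rw [h2] at h6
      simp only [hJ]
      linarith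
    have hpt : ∀ x ∈ Ω, ‖θ x * φ x * (((n : ℝ) + 1)
        * deriv smoothStep (-(((n : ℝ) + 1) * ρ x))) * fderiv ℝ ρ x (v x)‖
        ≤ C * κ * (θ x * (((n : ℝ) + 1) * deriv smoothStep (-(((n : ℝ) + 1) * ρ x)))) := by
      intro x hx
      by_cases hxθ : x ∈ tsupport θ
      · by_cases hlay : -δ ≤ ρ x
        · have h6 := hsm x ⟨hxθ, subset_closure hx⟩ hlay
          have h7 := deriv_smoothStep_nonneg (-(((n : ℝ) + 1) * ρ x))
          have h8 := hθ0 x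
          rw [norm_mul, norm_mul, norm_mul, Real.norm_eq_abs, Real.norm_eq_abs, Real.norm_eq_abs,
            Real.norm_eq_abs, abs_of_nonneg h8, abs_of_nonneg (mul_nonneg hm.le h7)]
          calc θ x * |φ x| * (((n : ℝ) + 1) * deriv smoothStep (-(((n : ℝ) + 1) * ρ x)))
                * |fderiv ℝ ρ x (v x)|
              ≤ θ x * C * (((n : ℝ) + 1) * deriv smoothStep (-(((n : ℝ) + 1) * ρ x))) * κ := by
                gcongr
                exact hφC x hx
            _ = _ := by ring
        · rw [deriv_smoothStep_eq_zero (by nlinarith)]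
          simp
      · simp [image_eq_zero_of_notMem_tsupport hxθ]
    rw [h5, ← Real.norm_eq_abs]
    calc _ ≤ ∫ x in Ω, C * κ
            * (θ x * (((n : ℝ) + 1) * deriv smoothStep (-(((n : ℝ) + 1) * ρ x)))) :=
          norm_integral_le_of_norm_le (h3.const_mul _)
            ((ae_restrict_iff' hΩ.measurableSet).2 (ae_of_all _ hpt))
      _ ≤ C * κ * A := by
          rw [integral_const_mul]
          exact mul_le_mul_of_nonneg_left h4 (by positivity)
  have hle : ∀ κ > 0, |∫ x in Ω, fderiv ℝ (fun y => θ y * φ y) x (v x)| ≤ C * κ * A := fun κ hκ =>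
    le_of_tendsto hlim.abs (hbound κ hκ)
  have hκ : Tendsto (fun κ : ℝ => C * κ * A) (𝓝[>] 0) (𝓝 0) := by
    have h : Tendsto (fun κ : ℝ => C * κ * A) (𝓝 0) (𝓝 (C * 0 * A)) :=
      (tendsto_id.const_mul C).mul_const A
    rw [mul_zero, zero_mul] at h
    exact h.mono_left nhdsWithin_le_nhds
  have h0 := ge_of_tendsto hκ (eventually_mem_nhdsWithin.mono fun κ h => hle κ h)
  exact abs_eq_zero.1 (le_antisymm h0 (abs_nonneg _))

/-- On a bounded domain with `C²` boundary, the gradient of a bounded function with bounded gradient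
is orthogonal to every tangential solenoidal field that is continuous up to the boundary. -/
theorem setIntegral_fderiv_apply_eq_zero_of_tangential {Ω : Set E3} {v : E3 → E3} {φ : E3 → ℝ}
    {C : ℝ} (hΩ : IsOpen Ω) (hb : Bornology.IsBounded Ω) (hC2 : HasC2Boundary Ω)
    (hv : ContDiffOn ℝ 1 v Ω) (hdiv : ∀ x ∈ Ω, divergence v x = 0)
    (hvc : ContinuousOn v (closure Ω))
    (htan : ∀ q ∈ frontier Ω, ∀ n, IsOutwardUnitNormal Ω q n → inner ℝ (v q) n = 0)
    (hφ : ContDiffOn ℝ 1 φ Ω) (hφC : ∀ x ∈ Ω, |φ x| ≤ C) (hφ' : ∀ x ∈ Ω, ‖fderiv ℝ φ x‖ ≤ C) :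
    ∫ x in Ω, fderiv ℝ φ x (v x) = 0 := by
  classical
  rcases Ω.eq_empty_or_nonempty with rfl | ⟨x₀, hx₀⟩
  · simp
  have hC0 : 0 ≤ C := (abs_nonneg _).trans (hφC x₀ hx₀)
  have hcl : IsCompact (closure Ω) := hb.isCompact_closure
  obtain ⟨B, hB⟩ := hcl.exists_bound_of_continuousOn hvc
  have hφat : ∀ x ∈ Ω, ContDiffAt ℝ 1 φ x := fun x hx => hφ.contDiffAt (hΩ.mem_nhds hx)
  have hD : ∀ θ : E3 → ℝ, ContDiff ℝ 1 θ → HasCompactSupport θ → ∃ D, ∀ x ∈ Ω,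
      |fderiv ℝ (fun y => θ y * φ y) x (v x)| ≤ D := by
    intro θ hθ hθc
    obtain ⟨D₁, hD₁⟩ := hθ.continuous.bounded_above_of_compact_support hθc
    obtain ⟨D₂, hD₂⟩ := (hθ.continuous_fderiv one_ne_zero).bounded_above_of_compact_support
      (hθc.fderiv ℝ)
    have h1 : 0 ≤ D₁ := (norm_nonneg _).trans (hD₁ 0)
    have h2 : 0 ≤ D₂ := (norm_nonneg _).trans (hD₂ 0)
    refine ⟨(D₁ * C + C * D₂) * B, fun x hx => ?_⟩
    rw [← Real.norm_eq_abs, fderiv_fun_mul (hθ.differentiable one_ne_zero x)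
      ((hφat x hx).differentiableAt one_ne_zero)]
    refine (ContinuousLinearMap.le_opNorm _ _).trans ?_
    refine mul_le_mul ((norm_add_le _ _).trans ?_) (hB x (subset_closure hx)) (norm_nonneg _)
      (by positivity)
    rw [norm_smul, norm_smul]
    exact add_le_add (mul_le_mul (hD₁ x) (hφ' x hx) (norm_nonneg _) h1)
      (mul_le_mul (hφC x hx) (hD₂ x) (norm_nonneg _) hC0)
  have hloc : ∀ p : E3, ∃ r > 0, p ∈ closure Ω → ∀ θ : E3 → ℝ, ContDiff ℝ 1 θ →
      HasCompactSupport θ → tsupport θ ⊆ Metric.ball p r → (∀ x, 0 ≤ θ x) →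
      ∫ x in Ω, fderiv ℝ (fun y => θ y * φ y) x (v x) = 0 := by
    intro p
    by_cases hp : p ∈ closure Ω
    swap
    · exact ⟨1, one_pos, fun h => absurd h hp⟩
    by_cases hpΩ : p ∈ Ω
    · obtain ⟨r, hr, hball⟩ := Metric.isOpen_iff.1 hΩ p hpΩ
      refine ⟨r, hr, fun _ θ hθ hθc hθs _ => ?_⟩
      have hsub : tsupport (fun y => θ y * φ y) ⊆ Ω :=
        (tsupport_mul_subset_left).trans (hθs.trans hball)
      rw [setIntegral_eq_integral_of_forall_compl_eq_zero fun x hx => by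
        rw [fderiv_of_notMem_tsupport ℝ fun h => hx (hsub h)]
        simp]
      exact integral_fderiv_apply_eq_zero hθc.mul_right
        (fun x hx => hθ.contDiffAt.mul (hφat x (hsub hx)))
        (fun x hx => hv.contDiffAt (hΩ.mem_nhds (hsub hx))) fun x hx => hdiv x (hsub hx)
    · have hfr : p ∈ frontier Ω := by
        rw [hΩ.frontier_eq]
        exact ⟨hp, hpΩ⟩
      obtain ⟨U, ρ, hρ⟩ := hC2 p hfr
      obtain ⟨r, c, e, hr, hc, hrU, he⟩ := hρ.exists_transversal
      refine ⟨r, hr, fun _ θ hθ hθc hθs hθ0 => ?_⟩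
      obtain ⟨D, hD⟩ := hD θ hθ hθc
      exact setIntegral_fderiv_mul_eq_zero_near_frontier hΩ hb hρ hrU hc he hθ hθc hθs hθ0 hv hdiv
        hvc htan hφ hφC hD
  choose r hr hloc using hloc
  obtain ⟨t, ht, hcover⟩ := hcl.elim_nhds_subcover (fun p => Metric.ball p (r p))
    fun p _ => Metric.ball_mem_nhds p (hr p)
  obtain ⟨f, hf⟩ := SmoothPartitionOfUnity.exists_isSubordinate (modelWithCornersSelf ℝ E3)
    (s := closure Ω) isClosed_closure (fun p : t => Metric.ball (p : E3) (r p))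
    (fun p => Metric.isOpen_ball) (by simpa [iUnion_subtype] using hcover)
  have hsmooth : ∀ i, ContDiff ℝ 1 (f i) := fun i => (f i).contMDiff.contDiff.of_le (by simp)
  have hcs : ∀ i, HasCompactSupport (f i) := fun i =>
    Metric.isCompact_of_isClosed_isBounded (isClosed_tsupport _)
      (Metric.isBounded_ball.subset (hf i))
  have hsum : ∀ x ∈ Ω, ∑ i, fderiv ℝ (fun y => f i y * φ y) x (v x) = fderiv ℝ φ x (v x) := by
    intro x hx
    have h1 : (fun y => ∑ i, f i y * φ y) =ᶠ[𝓝 x] φ := by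
      filter_upwards [hΩ.mem_nhds hx] with y hy
      have h2 := f.sum_eq_one (subset_closure hy)
      rw [finsum_eq_sum_of_fintype] at h2
      rw [← Finset.sum_mul, h2, one_mul]
    rw [← h1.fderiv_eq, fderiv_fun_sum fun i _ => (((hsmooth i).contDiffAt.mul
      (hφat x hx)).differentiableAt one_ne_zero)]
    simp
  rw [← setIntegral_congr_fun hΩ.measurableSet hsum, integral_finsetSum]
  · exact Finset.sum_eq_zero fun i _ => hloc i (ht i i.2) (f i) (hsmooth i) (hcs i) (hf i)
      fun x => f.nonneg i x
  · intro i _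
    obtain ⟨D, hD⟩ := hD (f i) (hsmooth i) (hcs i)
    exact integrableOn_of_continuousOn_of_abs_le hΩ hb
      ((((hsmooth i).contDiffOn.mul hφ).continuousOn_fderiv_of_isOpen hΩ le_rfl).clm_apply
        hv.continuousOn) hD

/-- A function with bounded gradient on a bounded `C²` domain is bounded. Near a boundary point the
domain contains segments of a fixed length, along a fixed direction, that end in a ball inside. -/
lemma exists_abs_le_of_hasFDerivAt {Ω : Set E3} (hΩ : IsOpen Ω) (hb : Bornology.IsBounded Ω)
    (hC2 : HasC2Boundary Ω) {Q : E3 → ℝ} {Q' : E3 → E3 →L[ℝ] ℝ}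
    (hQ : ∀ x ∈ Ω, HasFDerivAt Q (Q' x) x) {C : ℝ} (hC : ∀ x ∈ Ω, ‖Q' x‖ ≤ C) :
    ∃ K, ∀ x ∈ Ω, |Q x| ≤ K := by
  have hmv : ∀ s : Set E3, Convex ℝ s → s ⊆ Ω → ∀ x ∈ s, ∀ y ∈ s, |Q y - Q x| ≤ C * ‖y - x‖ :=
    fun s hs hsΩ x hx y hy => hs.norm_image_sub_le_of_norm_hasFDerivWithin_le
      (fun z hz => (hQ z (hsΩ hz)).hasFDerivWithinAt) (fun z hz => hC z (hsΩ hz)) hx hy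
  have hball : ∀ p ∈ Ω, ∃ η > 0, ∃ K, ∀ x ∈ Metric.ball p η, x ∈ Ω ∧ |Q x| ≤ K := by
    intro p hp
    obtain ⟨η, hη, hsub⟩ := Metric.isOpen_iff.1 hΩ p hp
    have hC0 : 0 ≤ C := (norm_nonneg _).trans (hC p hp)
    refine ⟨η, hη, |Q p| + C * η, fun x hx => ⟨hsub hx, ?_⟩⟩
    have h1 := hmv _ (convex_ball p η) hsub p (Metric.mem_ball_self hη) x hx
    have h2 : ‖x - p‖ ≤ η := (mem_ball_iff_norm.1 hx).le
    have h3 := abs_sub_abs_le_abs_sub (Q x) (Q p)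
    have h4 : C * ‖x - p‖ ≤ C * η := by gcongr
    linarith
  have hloc : ∀ p ∈ closure Ω, ∃ W ∈ 𝓝[closure Ω] p, ∃ K, ∀ x ∈ W, x ∈ Ω → |Q x| ≤ K := by
    intro p hp
    by_cases hpΩ : p ∈ Ω
    · obtain ⟨η, hη, K, hK⟩ := hball p hpΩ
      exact ⟨_, mem_nhdsWithin_of_mem_nhds (Metric.ball_mem_nhds p hη), K,
        fun x hx _ => (hK x hx).2⟩
    have hfr : p ∈ frontier Ω := by
      rw [hΩ.frontier_eq]
      exact ⟨hp, hpΩ⟩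
    obtain ⟨U, ρ, hρ⟩ := hC2 p hfr
    obtain ⟨r, c, e, hr, hc, hrU, he⟩ := hρ.exists_transversal
    set δ := r / (2 * (‖e‖ + 1)) with hδdef
    have hδ : 0 < δ := by positivity
    have hδe : δ * ‖e‖ < r / 2 := by
      have h1 : δ * (‖e‖ + 1) = r / 2 := by
        rw [hδdef]
        field_simp
      linarith
    have hin : ∀ x ∈ Metric.ball p (r / 2), ∀ s ∈ Icc 0 δ, x - s • e ∈ Metric.ball p r := by
      intro x hx s hs
      rw [mem_ball_iff_norm] at hx ⊢
      have h1 : ‖s • e‖ ≤ δ * ‖e‖ := by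
        rw [norm_smul, Real.norm_eq_abs, abs_of_nonneg hs.1]
        exact mul_le_mul_of_nonneg_right hs.2 (norm_nonneg _)
      have h2 : ‖x - s • e - p‖ ≤ ‖x - p‖ + ‖s • e‖ := by
        rw [show x - s • e - p = (x - p) - s • e by abel]
        exact norm_sub_le _ _
      linarith
    have hdec : ∀ x ∈ Metric.ball p (r / 2), ∀ s ∈ Icc 0 δ, ρ (x - s • e) ≤ ρ x - c * s := by
      intro x hx s hs
      have hder : ∀ s ∈ Icc 0 δ, HasDerivAt (fun s => -ρ (x - s • e))
          (fderiv ℝ ρ (x - s • e) e) s := by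
        intro s hs
        have h1 : HasDerivAt (fun s : ℝ => x - s • e) (-e) s := by
          simpa using ((hasDerivAt_id s).smul_const e).const_sub x
        have h2 := (hρ.contDiffOn.contDiffAt
          (hρ.isOpen.mem_nhds (hrU (hin x hx s hs)))).differentiableAt two_ne_zero
        simpa using! (h2.hasFDerivAt.comp_hasDerivAt s h1).neg
      have h := (convex_Icc 0 δ).mul_sub_le_image_sub_of_le_deriv
        (f := fun s => -ρ (x - s • e)) (C := c)
        (fun s hs => (hder s hs).continuousAt.continuousWithinAt)
        (fun s hs => (hder s (interior_subset hs)).differentiableAt.differentiableWithinAt)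
        (fun s hs => by
          rw [(hder s (interior_subset hs)).deriv]
          exact he _ (hin x hx s (interior_subset hs))) 0 ⟨le_rfl, hδ.le⟩ s hs hs.1
      simp only [zero_smul, sub_zero] at h
      linarith
    have hq : p - δ • e ∈ Ω := by
      have hpb : p ∈ Metric.ball p (r / 2) := Metric.mem_ball_self (half_pos hr)
      have hm : δ ∈ Icc 0 δ := ⟨hδ.le, le_rfl⟩
      refine (hρ.mem_iff _ (hrU (hin p hpb δ hm))).2 ?_
      have h1 := hdec p hpb δ hm
      have h2 := hρ.nonpos_of_mem_closure hp hρ.mem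
      have h3 : 0 < c * δ := mul_pos hc hδ
      linarith
    obtain ⟨η, hη, K, hK⟩ := hball _ hq
    have hC0 : 0 ≤ C := (norm_nonneg _).trans (hC _ hq)
    refine ⟨_, mem_nhdsWithin_of_mem_nhds (inter_mem (Metric.ball_mem_nhds p (half_pos hr))
      (Metric.ball_mem_nhds p hη)), K + C * ‖δ • e‖, ?_⟩
    rintro x ⟨hx1, hx2⟩ hxΩ
    have hseg : segment ℝ (x - δ • e) x ⊆ Ω := by
      rw [segment_symm, segment_eq_image]
      rintro _ ⟨s, hs, rfl⟩
      have hsδ : s * δ ∈ Icc 0 δ := ⟨mul_nonneg hs.1 hδ.le, mul_le_of_le_one_left hδ.le hs.2⟩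
      have heq : (1 - s) • x + s • (x - δ • e) = x - (s * δ) • e := by
        rw [smul_sub, sub_smul, one_smul, mul_smul]
        abel
      simp only [heq]
      refine (hρ.mem_iff _ (hrU (hin x hx1 _ hsδ))).2 ?_
      have h1 := hdec x hx1 _ hsδ
      have h2 := (hρ.mem_iff x (hrU (Metric.ball_subset_ball (half_le_self hr.le) hx1))).1 hxΩ
      have h3 : 0 ≤ c * (s * δ) := mul_nonneg hc.le hsδ.1
      linarith
    have h1 := hmv _ (convex_segment _ _) hseg _
      (left_mem_segment ℝ _ _) _ (right_mem_segment ℝ _ _)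
    rw [sub_sub_cancel] at h1
    have h2 : x - δ • e ∈ Metric.ball (p - δ • e) η := by
      rw [mem_ball_iff_norm] at hx2 ⊢
      rwa [sub_sub_sub_cancel_right]
    have h3 := (hK _ h2).2
    have h4 := abs_sub_abs_le_abs_sub (Q x) (Q (x - δ • e))
    linarith
  obtain ⟨K, hK⟩ := hb.isCompact_closure.induction_on
    (p := fun S => ∃ K, ∀ x ∈ S, x ∈ Ω → |Q x| ≤ K) ⟨0, fun x hx => absurd hx (notMem_empty x)⟩
    (fun S T hST ⟨K, hK⟩ => ⟨K, fun x hx => hK x (hST hx)⟩)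
    (fun S T ⟨K, hK⟩ ⟨L, hL⟩ => ⟨max K L, fun x hx hxΩ => hx.elim
      (fun h => (hK x h hxΩ).trans (le_max_left _ _))
      fun h => (hL x h hxΩ).trans (le_max_right _ _)⟩) hloc
  exact ⟨K, fun x hx => hK x (subset_closure hx) hx⟩

/-- On a simply connected bounded `C²` domain, a bounded curl-free field is orthogonal to every
tangential solenoidal field that is continuous up to the boundary. -/
theorem setIntegral_inner_eq_zero_of_curl_eq_zero {Ω : Set E3} {F v : E3 → E3} {C : ℝ}
    (hΩ : IsOpen Ω) (hb : Bornology.IsBounded Ω) (hsc : SimplyConnectedSpace Ω)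
    (hC2 : HasC2Boundary Ω) (hF : DifferentiableOn ℝ F Ω) (hcurl : ∀ x ∈ Ω, curl F x = 0)
    (hFC : ∀ x ∈ Ω, ‖F x‖ ≤ C)
    (hv : ContDiffOn ℝ 1 v Ω) (hdiv : ∀ x ∈ Ω, divergence v x = 0)
    (hvc : ContinuousOn v (closure Ω))
    (htan : ∀ q ∈ frontier Ω, ∀ n, IsOutwardUnitNormal Ω q n → inner ℝ (v q) n = 0) :
    ∫ x in Ω, inner ℝ (F x) (v x) = 0 := by
  have hω : ∀ x ∈ Ω, HasFDerivAt (fun y => innerSL ℝ (F y)) (innerSL ℝ ∘L fderiv ℝ F x) x :=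
    fun x hx => ((innerSL ℝ).hasFDerivAt (x := F x)).comp x
      (hF.differentiableAt (hΩ.mem_nhds hx)).hasFDerivAt
  obtain ⟨Q, hQ⟩ := exists_hasFDerivAt_of_simplyConnected hΩ hsc
    (ω := fun y => innerSL ℝ (F y)) (fun x hx => (hω x hx).differentiableAt.differentiableWithinAt)
    fun x hx a b => by
      rw [(hω x hx).fderiv]
      exact inner_fderiv_comm_of_curl_eq_zero (hcurl x hx) a b
  have hnorm : ∀ x ∈ Ω, ‖innerSL ℝ (F x)‖ ≤ C := fun x hx => by
    rw [innerSL_apply_norm]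
    exact hFC x hx
  obtain ⟨K, hK⟩ := exists_abs_le_of_hasFDerivAt hΩ hb hC2 hQ hnorm
  have hQ1 : ContDiffOn ℝ 1 Q Ω := by
    rw [← zero_add 1, contDiffOn_succ_iff_fderiv_of_isOpen hΩ, contDiffOn_zero]
    refine ⟨fun x hx => (hQ x hx).differentiableAt.differentiableWithinAt, by simp, ?_⟩
    exact ContinuousOn.congr (f := fun x => innerSL ℝ (F x))
      ((innerSL ℝ).continuous.comp_continuousOn hF.continuousOn) fun x hx => (hQ x hx).fderiv
  have h := setIntegral_fderiv_apply_eq_zero_of_tangential (C := max K C) hΩ hb hC2 hv hdiv hvc htan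
    hQ1 (fun x hx => (hK x hx).trans (le_max_left _ _)) fun x hx => by
      rw [(hQ x hx).fderiv]
      exact (hnorm x hx).trans (le_max_right _ _)
  rw [← h]
  refine setIntegral_congr_fun hΩ.measurableSet fun x hx => ?_
  simp only [(hQ x hx).fderiv]
  rfl

/-! ### The curl of the momentum balance -/

/-- The curl of a field as a linear function of its Jacobian matrix. -/
noncomputable def curlMap : (E3 →L[ℝ] E3) →L[ℝ] E3 :=
  LinearMap.toContinuousLinearMap
    { toFun := fun A => !₂[A (EuclideanSpace.single 1 1) 2 - A (EuclideanSpace.single 2 1) 1,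
        A (EuclideanSpace.single 2 1) 0 - A (EuclideanSpace.single 0 1) 2,
        A (EuclideanSpace.single 0 1) 1 - A (EuclideanSpace.single 1 1) 0]
      map_add' := fun A B => by
        ext i
        fin_cases i <;> simp <;> ring
      map_smul' := fun c A => by
        ext i
        fin_cases i <;> simp <;> ring }

lemma curl_eq_curlMap (v : E3 → E3) (x : E3) : curl v x = curlMap (fderiv ℝ v x) := rfl

lemma curlMap_apply (A : E3 →L[ℝ] E3) : curlMap A
    = !₂[A (EuclideanSpace.single 1 1) 2 - A (EuclideanSpace.single 2 1) 1,
        A (EuclideanSpace.single 2 1) 0 - A (EuclideanSpace.single 0 1) 2,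
        A (EuclideanSpace.single 0 1) 1 - A (EuclideanSpace.single 1 1) 0] := rfl

/-- The convective derivative `(v·∇)v`. -/
noncomputable def convection (v : E3 → E3) (x : E3) : E3 := fderiv ℝ v x (v x)

lemma clm_apply_coord (A : E3 →L[ℝ] E3) (y : E3) (j : Fin 3) :
    A y j = ∑ i, y i * A (EuclideanSpace.single i 1) j := by
  conv_lhs => rw [← sum_smul_single y]
  simp

/-- For a solenoidal field, `∇ × (v·∇)v = (v·∇)ω - (ω·∇)v` with `ω = ∇ × v`. -/
lemma curl_convection {v : E3 → E3} {x : E3} (hv : ContDiffAt ℝ 2 v x)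
    (hdiv : divergence v x = 0) :
    curl (convection v) x = fderiv ℝ (curl v) x (v x) - fderiv ℝ v x (curl v x) := by
  have h1 : HasFDerivAt v (fderiv ℝ v x) x := (hv.differentiableAt two_ne_zero).hasFDerivAt
  have h2 : HasFDerivAt (fderiv ℝ v) (fderiv ℝ (fderiv ℝ v) x) x :=
    ((hv.fderiv_right (m := 1) (by norm_num)).differentiableAt one_ne_zero).hasFDerivAt
  have hsymm : ∀ a b, fderiv ℝ (fderiv ℝ v) x a b = fderiv ℝ (fderiv ℝ v) x b a := fun a b =>
    (hv.isSymmSndFDerivAt (by simp)).eq a b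
  have h3 : HasFDerivAt (convection v) _ x := h2.clm_apply h1
  have h4 : HasFDerivAt (curl v) _ x := curlMap.hasFDerivAt.comp x h2
  rw [curl_eq_curlMap, h3.fderiv, h4.fderiv, curl_eq_curlMap]
  simp only [divergence, partialDeriv, Fin.sum_univ_three] at hdiv
  set A := fderiv ℝ v x
  set B := fderiv ℝ (fderiv ℝ v) x
  have hB := fun i => hsymm (v x) (EuclideanSpace.single i 1)
  have hAc := clm_apply_coord A (curlMap A)
  have hAA := fun k => clm_apply_coord A (A (EuclideanSpace.single k 1))
  ext i
  fin_cases i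
  all_goals
    simp [hAc, Fin.sum_univ_three]
    simp [curlMap_apply, hAA, hB, Fin.sum_univ_three]
  · linear_combination (A (EuclideanSpace.single 1 1) 2 - A (EuclideanSpace.single 2 1) 1) * hdiv
  · linear_combination (A (EuclideanSpace.single 2 1) 0 - A (EuclideanSpace.single 0 1) 2) * hdiv
  · linear_combination (A (EuclideanSpace.single 0 1) 1 - A (EuclideanSpace.single 1 1) 0) * hdiv

lemma continuousOn_time_slice {Y : Type*} [TopologicalSpace Y] {Ω : Set E3} {τ : ℝ}
    {F : ℝ × E3 → Y} (hF : ContinuousOn F (Icc 0 τ ×ˢ Ω)) {x : E3} (hx : x ∈ Ω) :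
    ContinuousOn (fun r => F (r, x)) (Icc 0 τ) :=
  hF.comp (by fun_prop) fun _ hr => ⟨hr, hx⟩

section Slices

variable {G : Type*} [NormedAddCommGroup G] [NormedSpace ℝ G] {Ω : Set E3} {τ : ℝ}
  {g : ℝ × E3 → G}

lemma hasFDerivAt_slice (hΩ : IsOpen Ω) (hg : ContDiffOn ℝ (⊤ : ℕ∞) g (Icc 0 τ ×ˢ Ω))
    {z : ℝ × E3} (hz : z ∈ Icc 0 τ ×ˢ Ω) :
    HasFDerivAt (fun x => g (z.1, x))
      (fderivWithin ℝ g (Icc 0 τ ×ˢ Ω) z ∘L ContinuousLinearMap.inr ℝ ℝ E3) z.2 := by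
  have h1 : HasFDerivWithinAt g (fderivWithin ℝ g (Icc 0 τ ×ˢ Ω) z) (Icc 0 τ ×ˢ Ω) (z.1, z.2) :=
    (hg.differentiableOn (by simp) z hz).hasFDerivWithinAt
  have h2 : HasFDerivWithinAt (fun x : E3 => (z.1, x)) (ContinuousLinearMap.inr ℝ ℝ E3) Ω z.2 :=
    (hasFDerivAt_prodMk_right z.1 z.2).hasFDerivWithinAt
  exact (h1.comp z.2 h2 fun x hx => ⟨hz.1, hx⟩).hasFDerivAt (hΩ.mem_nhds hz.2)

/-- Differentiation in space preserves smoothness in space-time. -/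
lemma contDiffOn_fderiv_slice (hΩ : IsOpen Ω) (hτ : 0 < τ)
    (hg : ContDiffOn ℝ (⊤ : ℕ∞) g (Icc 0 τ ×ˢ Ω)) :
    ContDiffOn ℝ (⊤ : ℕ∞) (fun z : ℝ × E3 => fderiv ℝ (fun x => g (z.1, x)) z.2)
      (Icc 0 τ ×ˢ Ω) := by
  have hu : UniqueDiffOn ℝ (Icc 0 τ ×ˢ Ω) := (uniqueDiffOn_Icc hτ).prod hΩ.uniqueDiffOn
  have h1 : ContDiffOn ℝ (⊤ : ℕ∞) (fderivWithin ℝ g (Icc 0 τ ×ˢ Ω)) (Icc 0 τ ×ˢ Ω) :=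
    hg.fderivWithin hu (by simp)
  exact (h1.clm_comp contDiffOn_const).congr fun z hz => (hasFDerivAt_slice hΩ hg hz).fderiv

lemma contDiffOn_slice (hg : ContDiffOn ℝ (⊤ : ℕ∞) g (Icc 0 τ ×ˢ Ω)) {t : ℝ}
    (ht : t ∈ Icc 0 τ) : ContDiffOn ℝ (⊤ : ℕ∞) (fun x => g (t, x)) Ω :=
  hg.comp (contDiff_prodMk_right t).contDiffOn fun _ hx => ⟨ht, hx⟩

lemma hasFDerivAt_integral_slice [CompleteSpace G] (hΩ : IsOpen Ω) (hτ : 0 < τ)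
    (hg : ContDiffOn ℝ (⊤ : ℕ∞) g (Icc 0 τ ×ˢ Ω)) {s t : ℝ} (hs : s ∈ Icc 0 τ) (ht : t ∈ Icc 0 τ)
    {x : E3} (hx : x ∈ Ω) :
    HasFDerivAt (fun x => ∫ r in s..t, g (r, x))
      (∫ r in s..t, fderiv ℝ (fun y => g (r, y)) x) x := by
  have hD := (contDiffOn_fderiv_slice hΩ hτ hg).continuousOn
  have hsub : uIcc s t ⊆ Icc 0 τ := uIcc_subset_Icc hs ht
  have hsub' : Ι s t ⊆ Icc 0 τ := uIoc_subset_uIcc.trans hsub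
  obtain ⟨η, hη, hball⟩ := Metric.nhds_basis_closedBall.mem_iff.1 (hΩ.mem_nhds hx)
  obtain ⟨C, hC⟩ := ((isCompact_Icc (a := (0 : ℝ)) (b := τ)).prod
    (isCompact_closedBall x η)).exists_bound_of_continuousOn
    (hD.mono (prod_mono_right hball))
  have hball' : Metric.ball x η ⊆ Ω := Metric.ball_subset_closedBall.trans hball
  refine intervalIntegral.hasFDerivAt_integral_of_dominated_of_fderiv_le
    (F := fun x r => g (r, x)) (F' := fun x r => fderiv ℝ (fun y => g (r, y)) x)
    (bound := fun _ => C) (Metric.ball_mem_nhds x hη) ?_ ?_ ?_ ?_ ?_ ?_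
  · filter_upwards [hΩ.mem_nhds hx] with y hy
    exact ((continuousOn_time_slice hg.continuousOn hy).mono hsub').aestronglyMeasurable
      measurableSet_uIoc
  · exact ((continuousOn_time_slice hg.continuousOn hx).mono hsub).intervalIntegrable
  · exact ((continuousOn_time_slice hD hx).mono hsub').aestronglyMeasurable measurableSet_uIoc
  · exact ae_of_all _ fun r hr y hy => hC (r, y) ⟨hsub' hr, Metric.ball_subset_closedBall hy⟩
  · exact intervalIntegrable_const
  · refine ae_of_all _ fun r hr y hy => ?_
    have hz : (r, y) ∈ Icc 0 τ ×ˢ Ω := ⟨hsub' hr, hball' hy⟩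
    exact (hasFDerivAt_slice hΩ hg hz).differentiableAt.hasFDerivAt

end Slices

section Flow

variable {Ω : Set E3} {T : EReal} {u ω : ℝ → E3 → E3} {τ : ℝ}

lemma Icc_subset_timeInterval (hτ : τ ∈ timeInterval T) : Icc 0 τ ⊆ timeInterval T := fun _ ht =>
  ⟨ht.1, lt_of_le_of_lt (EReal.coe_le_coe_iff.2 ht.2) hτ.2⟩

lemma IsSmoothVorticityFlow.contDiffOn_velocity (h : IsSmoothVorticityFlow Ω T u ω)
    (hτ : τ ∈ timeInterval T) :
    ContDiffOn ℝ (⊤ : ℕ∞) (fun z : ℝ × E3 => u z.1 z.2) (Icc 0 τ ×ˢ Ω) :=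
  h.smooth_velocity.mono (prod_mono_left (Icc_subset_timeInterval hτ))

lemma IsSmoothVorticityFlow.contDiffOn_convection (h : IsSmoothVorticityFlow Ω T u ω)
    (hΩ : IsOpen Ω) (hτ : τ ∈ timeInterval T) (hτ0 : 0 < τ) :
    ContDiffOn ℝ (⊤ : ℕ∞) (fun z : ℝ × E3 => convection (u z.1) z.2) (Icc 0 τ ×ˢ Ω) :=
  (contDiffOn_fderiv_slice hΩ hτ0 (h.contDiffOn_velocity hτ)).clm_apply (h.contDiffOn_velocity hτ)

/-- The velocity increment plus the accumulated convection, which is minus a time-integrated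
pressure gradient. -/
noncomputable def momentumDefect (u : ℝ → E3 → E3) (s t : ℝ) (x : E3) : E3 :=
  u t x - u s x + ∫ r in s..t, convection (u r) x

lemma IsSmoothVorticityFlow.differentiableOn_momentumDefect (h : IsSmoothVorticityFlow Ω T u ω)
    (hΩ : IsOpen Ω) (hτ : τ ∈ timeInterval T) (hτ0 : 0 < τ) {s t : ℝ} (hs : s ∈ Icc 0 τ)
    (ht : t ∈ Icc 0 τ) : DifferentiableOn ℝ (momentumDefect u s t) Ω := fun x hx =>
  ((((contDiffOn_slice (h.contDiffOn_velocity hτ) ht).differentiableOn (by simp) x hx).sub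
    ((contDiffOn_slice (h.contDiffOn_velocity hτ) hs).differentiableOn (by simp) x hx)).add
    (hasFDerivAt_integral_slice hΩ hτ0 (h.contDiffOn_convection hΩ hτ hτ0) hs ht
      hx).differentiableAt.differentiableWithinAt)

/-- The vorticity equation says that the momentum defect is curl-free. -/
lemma IsSmoothVorticityFlow.curl_momentumDefect (h : IsSmoothVorticityFlow Ω T u ω)
    (hΩ : IsOpen Ω) (hτ : τ ∈ timeInterval T) (hτ0 : 0 < τ) {s t : ℝ} (hs : s ∈ Icc 0 τ)
    (ht : t ∈ Icc 0 τ) (hst : s ≤ t) {x : E3} (hx : x ∈ Ω) :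
    curl (momentumDefect u s t) x = 0 := by
  have hI := Icc_subset_timeInterval hτ
  have hu := h.contDiffOn_velocity hτ
  have hN := h.contDiffOn_convection hΩ hτ hτ0
  have hst' : Icc s t ⊆ Icc 0 τ := Icc_subset_Icc hs.1 ht.2
  have hdt : ∀ r ∈ Icc 0 τ, DifferentiableAt ℝ (u r) x := fun r hr =>
    ((contDiffOn_slice hu hr).contDiffAt (hΩ.mem_nhds hx)).differentiableAt (by simp)
  have hcurl : ∀ r ∈ Icc 0 τ, curl (convection (u r)) x
      = -(fderiv ℝ (u r) x (ω r x) - fderiv ℝ (ω r) x (u r x)) := by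
    intro r hr
    have h1 : ω r =ᶠ[𝓝 x] curl (u r) := by
      filter_upwards [hΩ.mem_nhds hx] with y hy using h.vorticity_eq_curl r (hI hr) y hy
    rw [curl_convection (((contDiffOn_slice hu hr).contDiffAt (hΩ.mem_nhds hx)).of_le
      (WithTop.coe_le_coe.2 (le_top : (2 : ℕ∞) ≤ ⊤))) (h.divergence_free r (hI hr) x hx),
      h1.fderiv_eq, h.vorticity_eq_curl r (hI hr) x hx]
    abel
  have hDN := (contDiffOn_fderiv_slice hΩ hτ0 hN).continuousOn
  have hDNx : ContinuousOn (fun r => fderiv ℝ (convection (u r)) x) (Icc s t) :=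
    (continuousOn_time_slice hDN hx).mono hst'
  have hωx : ContinuousOn (fun r => ω r x) (Icc s t) := fun r hr =>
    ((h.vorticity_equation r (hI (hst' hr)) x hx).continuousWithinAt).mono (hst'.trans hI)
  have hder : ∀ r ∈ Ioo s t, HasDerivAt (fun r => ω r x)
      (fderiv ℝ (u r) x (ω r x) - fderiv ℝ (ω r) x (u r x)) r := fun r hr =>
    (h.vorticity_equation r (hI (hst' (Ioo_subset_Icc_self hr))) x hx).hasDerivAt
      (mem_of_superset (Icc_mem_nhds hr.1 hr.2) (hst'.trans hI))
  have hcc : ContinuousOn (fun r => -curl (convection (u r)) x) (Icc s t) :=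
    (curlMap.continuous.comp_continuousOn hDNx).neg
  have hftc : ∫ r in s..t, -curl (convection (u r)) x = ω t x - ω s x := by
    refine intervalIntegral.integral_eq_sub_of_hasDerivAt_of_le hst hωx (fun r hr => ?_)
      (hcc.intervalIntegrable_of_Icc hst)
    rw [hcurl r (hst' (Ioo_subset_Icc_self hr)), neg_neg]
    exact hder r hr
  have hF : HasFDerivAt (momentumDefect u s t)
      (fderiv ℝ (u t) x - fderiv ℝ (u s) x + ∫ r in s..t, fderiv ℝ (convection (u r)) x) x :=
    ((hdt t ht).hasFDerivAt.sub (hdt s hs).hasFDerivAt).add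
      (hasFDerivAt_integral_slice hΩ hτ0 hN hs ht hx)
  rw [curl_eq_curlMap, hF.fderiv, map_add, map_sub, ← curl_eq_curlMap, ← curl_eq_curlMap,
    ← ContinuousLinearMap.intervalIntegral_comp_comm _ (hDNx.intervalIntegrable_of_Icc hst),
    ← h.vorticity_eq_curl t (hI ht) x hx, ← h.vorticity_eq_curl s (hI hs) x hx, ← hftc,
    intervalIntegral.integral_neg]
  exact neg_add_cancel _

end Flow

/-! ### The energy estimate -/

/-- Grönwall's inequality for a weak evolution equation `w' = G`, tested only against the values of
`w` itself, in a Hilbert space. No time regularity of `w` is presupposed. -/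
theorem eq_zero_of_weak_evolution {H : Type*} [NormedAddCommGroup H] [InnerProductSpace ℝ H]
    {w G : ℝ → H} {τ M C : ℝ} (hC : 0 ≤ C) (hG : ∀ r ∈ Icc 0 τ, ‖G r‖ ≤ C)
    (hw : ∀ s ∈ Icc 0 τ, ∀ t ∈ Icc 0 τ, s ≤ t → ∀ a ∈ Icc 0 τ,
      IntervalIntegrable (fun r => inner ℝ (G r) (w a)) volume s t ∧
      inner ℝ (w t - w s) (w a) = ∫ r in s..t, inner ℝ (G r) (w a))
    (hM : ∀ r ∈ Icc 0 τ, inner ℝ (G r) (w r) ≤ M * ‖w r‖ ^ 2) (h0 : w 0 = 0) :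
    ∀ t ∈ Icc 0 τ, w t = 0 := by
  rcases lt_or_ge τ 0 with hτ | hτ
  · intro t ht
    linarith [ht.1, ht.2]
  have hz : (0 : ℝ) ∈ Icc 0 τ := ⟨le_rfl, hτ⟩
  -- `w` is Lipschitz: test the increment against itself
  have hlip : ∀ s ∈ Icc 0 τ, ∀ t ∈ Icc 0 τ, s ≤ t → ‖w t - w s‖ ≤ C * (t - s) := by
    intro s hs t ht hst
    obtain ⟨i1, e1⟩ := hw s hs t ht hst t ht
    obtain ⟨i2, e2⟩ := hw s hs t ht hst s hs
    have h1 : ‖w t - w s‖ ^ 2 = ∫ r in s..t, inner ℝ (G r) (w t - w s) := by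
      rw [← real_inner_self_eq_norm_sq]
      rw [inner_sub_right (w t - w s), e1, e2, ← intervalIntegral.integral_sub i1 i2]
      simp_rw [inner_sub_right]
    have h2 : ‖w t - w s‖ ^ 2 ≤ C * ‖w t - w s‖ * (t - s) := by
      rw [h1]
      refine (le_abs_self _).trans ?_
      have h3 := intervalIntegral.norm_integral_le_of_norm_le_const (a := s) (b := t)
        (f := fun r => inner ℝ (G r) (w t - w s)) (C := C * ‖w t - w s‖) fun r hr => by
          rw [uIoc_of_le hst] at hr
          exact (norm_inner_le_norm _ _).trans (mul_le_mul_of_nonneg_right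
            (hG r ⟨hs.1.trans hr.1.le, hr.2.trans ht.2⟩) (norm_nonneg _))
      rwa [abs_of_nonneg (sub_nonneg.2 hst), Real.norm_eq_abs] at h3
    rcases (norm_nonneg (w t - w s)).eq_or_lt with h3 | h3
    · rw [← h3]
      exact mul_nonneg hC (sub_nonneg.2 hst)
    · nlinarith
  have hbd : ∀ t ∈ Icc 0 τ, ‖w t‖ ≤ C * τ := by
    intro t ht
    have h1 := hlip 0 hz t ht ht.1
    rw [h0, sub_zero, sub_zero] at h1
    exact h1.trans (mul_le_mul_of_nonneg_left ht.2 hC)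
  have hCτ : 0 ≤ C * τ := mul_nonneg hC hτ
  have hsq : ∀ s ∈ Icc 0 τ, ∀ t ∈ Icc 0 τ, s ≤ t →
      |‖w t‖ ^ 2 - ‖w s‖ ^ 2| ≤ 2 * C ^ 2 * τ * (t - s) := by
    intro s hs t ht hst
    have h1 := (abs_norm_sub_norm_le (w t) (w s)).trans (hlip s hs t ht hst)
    have h2 : ‖w t‖ ^ 2 - ‖w s‖ ^ 2 = (‖w t‖ + ‖w s‖) * (‖w t‖ - ‖w s‖) := by ring
    rw [h2, abs_mul, abs_of_nonneg (by positivity)]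
    calc (‖w t‖ + ‖w s‖) * |‖w t‖ - ‖w s‖| ≤ (C * τ + C * τ) * (C * (t - s)) := by
          gcongr
          · exact hbd t ht
          · exact hbd s hs
      _ = _ := by ring
  -- test the increment against `w t + w s`; replacing both by `w r` costs `O(t - s)`, as does
  -- replacing `‖w r‖ ^ 2` by `‖w s‖ ^ 2`, and `L` collects these Lipschitz constants
  set L : ℝ := 2 * |M| * (2 * C ^ 2 * τ) + 2 * C ^ 2
  have hL : 0 ≤ L := by positivity
  have hstep : ∀ s ∈ Icc 0 τ, ∀ t ∈ Icc 0 τ, s ≤ t →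
      ‖w t‖ ^ 2 - ‖w s‖ ^ 2 ≤ (2 * |M| * ‖w s‖ ^ 2 + L * (t - s)) * (t - s) := by
    intro s hs t ht hst
    obtain ⟨i1, e1⟩ := hw s hs t ht hst t ht
    obtain ⟨i2, e2⟩ := hw s hs t ht hst s hs
    have h1 : ‖w t‖ ^ 2 - ‖w s‖ ^ 2
        = ∫ r in s..t, (inner ℝ (G r) (w t) + inner ℝ (G r) (w s)) := by
      rw [intervalIntegral.integral_add i1 i2, ← e1, ← e2, inner_sub_left, inner_sub_left,
        real_inner_self_eq_norm_sq, real_inner_self_eq_norm_sq, real_inner_comm (w s) (w t)]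
      ring
    have h2 : ∀ r ∈ Icc s t, inner ℝ (G r) (w t) + inner ℝ (G r) (w s)
        ≤ 2 * |M| * ‖w s‖ ^ 2 + L * (t - s) := by
      intro r hr
      have hrτ : r ∈ Icc 0 τ := ⟨hs.1.trans hr.1, hr.2.trans ht.2⟩
      have h3 : inner ℝ (G r) (w t) = inner ℝ (G r) (w r) + inner ℝ (G r) (w t - w r) := by
        rw [inner_sub_right]
        ring
      have h4 : inner ℝ (G r) (w s) = inner ℝ (G r) (w r) - inner ℝ (G r) (w r - w s) := by
        rw [inner_sub_right]
        ring
      have h5 : inner ℝ (G r) (w t - w r) ≤ C * (C * (t - s)) :=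
        (real_inner_le_norm _ _).trans (mul_le_mul (hG r hrτ) ((hlip r hrτ t ht hr.2).trans
          (mul_le_mul_of_nonneg_left (by linarith [hr.1]) hC)) (norm_nonneg _) hC)
      have h6 : -inner ℝ (G r) (w r - w s) ≤ C * (C * (t - s)) :=
        (neg_le_abs _).trans ((abs_real_inner_le_norm _ _).trans (mul_le_mul (hG r hrτ)
          ((hlip s hs r hrτ hr.1).trans (mul_le_mul_of_nonneg_left (by linarith [hr.2]) hC))
          (norm_nonneg _) hC))
      have h7 := hM r hrτ
      have h8 : M * ‖w r‖ ^ 2 ≤ |M| * ‖w r‖ ^ 2 :=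
        mul_le_mul_of_nonneg_right (le_abs_self M) (sq_nonneg _)
      have h9 : |M| * ‖w r‖ ^ 2 ≤ |M| * (‖w s‖ ^ 2 + 2 * C ^ 2 * τ * (t - s)) := by
        refine mul_le_mul_of_nonneg_left ?_ (abs_nonneg M)
        have h10 := (le_abs_self _).trans (hsq s hs r hrτ hr.1)
        have h11 : 2 * C ^ 2 * τ * (r - s) ≤ 2 * C ^ 2 * τ * (t - s) :=
          mul_le_mul_of_nonneg_left (by linarith [hr.2]) (by positivity)
        linarith
      rw [h3, h4]
      simp only [L]
      nlinarith
    rw [h1]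
    refine (intervalIntegral.integral_mono_on hst (i1.add i2) intervalIntegrable_const h2).trans
      (le_of_eq ?_)
    rw [intervalIntegral.integral_const, smul_eq_mul, mul_comm]
  have hcont : ContinuousOn (fun t => ‖w t‖ ^ 2) (Icc 0 τ) := by
    refine LipschitzOnWith.continuousOn (K := Real.toNNReal (2 * C ^ 2 * τ))
      (LipschitzOnWith.of_dist_le_mul fun s hs t ht => ?_)
    rw [Real.coe_toNNReal _ (by positivity), Real.dist_eq, Real.dist_eq]
    rcases le_total s t with h | h
    · rw [abs_sub_comm, abs_sub_comm s t, abs_of_nonneg (sub_nonneg.2 h)]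
      exact hsq s hs t ht h
    · rw [abs_of_nonneg (sub_nonneg.2 h)]
      exact hsq t ht s hs h
  have hgron := le_gronwallBound_of_liminf_deriv_right_le (f := fun t => ‖w t‖ ^ 2)
    (f' := fun t => 2 * |M| * ‖w t‖ ^ 2) (δ := 0) (K := 2 * |M|) (ε := 0) (a := 0) (b := τ) hcont
    (fun s hs r hr => by
      have hlim : Tendsto (fun z => 2 * |M| * ‖w s‖ ^ 2 + L * (z - s)) (𝓝[>] s)
          (𝓝 (2 * |M| * ‖w s‖ ^ 2)) := by
        have h1 : Continuous fun z => 2 * |M| * ‖w s‖ ^ 2 + L * (z - s) := by fun_prop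
        have h2 := h1.tendsto s
        simp only [sub_self, mul_zero, add_zero] at h2
        exact h2.mono_left nhdsWithin_le_nhds
      have hev : ∀ᶠ z in 𝓝[>] s, (z - s)⁻¹ * (‖w z‖ ^ 2 - ‖w s‖ ^ 2) < r := by
        filter_upwards [hlim.eventually (gt_mem_nhds hr), Ioo_mem_nhdsGT hs.2] with z hz1 hz2
        refine lt_of_le_of_lt ?_ hz1
        have hzs : 0 < z - s := sub_pos.2 hz2.1
        rw [inv_mul_eq_div, div_le_iff₀ hzs]
        exact hstep s ⟨hs.1, hs.2.le⟩ z ⟨hs.1.trans hz2.1.le, hz2.2.le⟩ hz2.1.le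
      exact hev.frequently)
    (by simp [h0]) (fun s _ => by simp)
  intro t ht
  have h1 := hgron t ht
  rw [gronwallBound_ε0_δ0] at h1
  have h2 : ‖w t‖ ^ 2 = 0 := le_antisymm h1 (sq_nonneg _)
  exact norm_eq_zero.1 (pow_eq_zero_iff two_ne_zero |>.1 h2)

/-- Jensen's inequality for the square of the norm of a time integral. -/
lemma norm_integral_sq_le {a : ℝ → E3} {s t : ℝ} (hst : s ≤ t) (ha : ContinuousOn a (Icc s t)) :
    ‖∫ r in s..t, a r‖ ^ 2 ≤ (t - s) * ∫ r in s..t, ‖a r‖ ^ 2 := by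
  rcases hst.eq_or_lt with rfl | hlt
  · simp
  set m := ∫ r in s..t, a r
  have hai : IntervalIntegrable a volume s t := ha.intervalIntegrable_of_Icc hst
  have hm : ContinuousOn (fun r => inner ℝ (a r) m) (Icc s t) := ha.inner continuousOn_const
  have h2 : ContinuousOn (fun r => ‖a r‖ ^ 2) (Icc s t) := ha.norm.pow 2
  have hinner : ∫ r in s..t, inner ℝ (a r) m = ‖m‖ ^ 2 := by
    rw [← real_inner_self_eq_norm_sq]
    have h := ((innerSL ℝ m).intervalIntegral_comp_comm hai)
    simp only [innerSL_apply_apply] at h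
    rw [← h]
    exact intervalIntegral.integral_congr fun r _ => real_inner_comm _ _
  have hsq : ∀ r, ‖(t - s) • a r - m‖ ^ 2
      = (t - s) ^ 2 * ‖a r‖ ^ 2 - 2 * (t - s) * inner ℝ (a r) m + ‖m‖ ^ 2 := by
    intro r
    rw [norm_sub_sq_real, norm_smul, Real.norm_eq_abs, mul_pow, sq_abs, real_inner_smul_left]
    ring
  have h0 : 0 ≤ ∫ r in s..t, ‖(t - s) • a r - m‖ ^ 2 :=
    intervalIntegral.integral_nonneg hst fun r _ => sq_nonneg _
  have i1 := (h2.const_mul ((t - s) ^ 2)).intervalIntegrable_of_Icc (μ := volume) hst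
  have i2 := (hm.const_mul (2 * (t - s))).intervalIntegrable_of_Icc (μ := volume) hst
  simp_rw [hsq] at h0
  rw [intervalIntegral.integral_add (i1.sub i2) intervalIntegrable_const,
    intervalIntegral.integral_sub i1 i2, intervalIntegral.integral_const_mul,
    intervalIntegral.integral_const_mul, hinner, intervalIntegral.integral_const, smul_eq_mul] at h0
  have hpos : 0 < t - s := sub_pos.2 hlt
  nlinarith

section Flow

variable {Ω : Set E3} {T : EReal} {u ω : ℝ → E3 → E3} {τ E M : ℝ}

/-- The space-time integrability of a velocity field with bounded energy. -/
lemma IsSmoothVorticityFlow.integrable_prod_sq (h : IsSmoothVorticityFlow Ω T u ω) (hΩ : IsOpen Ω)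
    (hτ : τ ∈ timeInterval T)
    (hE : ∀ t ∈ Icc 0 τ, IntegrableOn (fun x => ‖u t x‖ ^ 2) Ω ∧ ∫ x in Ω, ‖u t x‖ ^ 2 ≤ E)
    {s t : ℝ} (hs : s ∈ Icc 0 τ) (ht : t ∈ Icc 0 τ) :
    Integrable (fun z : ℝ × E3 => ‖u z.1 z.2‖ ^ 2)
      ((volume.restrict (Ioc s t)).prod (volume.restrict Ω)) := by
  have hsub : Ioc s t ⊆ Icc 0 τ := fun r hr => ⟨hs.1.trans hr.1.le, hr.2.trans ht.2⟩
  have hmeas : AEStronglyMeasurable (fun z : ℝ × E3 => ‖u z.1 z.2‖ ^ 2)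
      ((volume.restrict (Ioc s t)).prod (volume.restrict Ω)) := by
    rw [Measure.prod_restrict]
    exact (((h.contDiffOn_velocity hτ).continuousOn.mono (prod_mono_left hsub)).norm.pow
      2).aestronglyMeasurable (measurableSet_Ioc.prod hΩ.measurableSet)
  refine (integrable_prod_iff hmeas).2
    ⟨(ae_restrict_iff' measurableSet_Ioc).2 (ae_of_all _ fun r hr => (hE r (hsub hr)).1), ?_⟩
  refine Integrable.mono' (g := fun _ => E) (integrable_const _)
    hmeas.norm.integral_prod_right' ((ae_restrict_iff' measurableSet_Ioc).2
      (ae_of_all _ fun r hr => ?_))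
  simp only [norm_pow, norm_norm]
  rw [Real.norm_eq_abs, abs_of_nonneg (integral_nonneg fun x => by positivity)]
  exact (hE r (hsub hr)).2

lemma norm_convection_le {v : E3 → E3} {x : E3} (h : ‖fderiv ℝ v x‖ ≤ M) :
    ‖convection v x‖ ≤ M * ‖v x‖ :=
  (ContinuousLinearMap.le_opNorm _ _).trans (mul_le_mul_of_nonneg_right h (norm_nonneg _))

/-- The weak form of the momentum balance, for a test field orthogonal to the momentum defect. -/
lemma IsSmoothVorticityFlow.weak_momentum (h : IsSmoothVorticityFlow Ω T u ω) (hΩ : IsOpen Ω)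
    (hτ : τ ∈ timeInterval T) (hτ0 : 0 < τ)
    (hE : ∀ t ∈ Icc 0 τ, IntegrableOn (fun x => ‖u t x‖ ^ 2) Ω ∧ ∫ x in Ω, ‖u t x‖ ^ 2 ≤ E)
    (hM : ∀ t ∈ Icc 0 τ, ∀ x ∈ Ω, ‖fderiv ℝ (u t) x‖ ≤ M)
    {s t : ℝ} (hs : s ∈ Icc 0 τ) (ht : t ∈ Icc 0 τ) (hst : s ≤ t) {v : E3 → E3}
    (hv : ContinuousOn v Ω) (hv2 : IntegrableOn (fun x => ‖v x‖ ^ 2) Ω)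
    (horth : ∫ x in Ω, inner ℝ (momentumDefect u s t x) (v x) = 0) :
    IntervalIntegrable (fun r => ∫ x in Ω, inner ℝ (convection (u r) x) (v x)) volume s t ∧
    ∫ x in Ω, inner ℝ (u t x - u s x) (v x)
      = -∫ r in s..t, ∫ x in Ω, inner ℝ (convection (u r) x) (v x) := by
  have hsub : Ioc s t ⊆ Icc 0 τ := fun r hr => ⟨hs.1.trans hr.1.le, hr.2.trans ht.2⟩
  have hN := (h.contDiffOn_convection hΩ hτ hτ0).continuousOn
  have hvm : AEStronglyMeasurable v (volume.restrict Ω) := hv.aestronglyMeasurable hΩ.measurableSet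
  have hut : ∀ t ∈ Icc 0 τ, AEStronglyMeasurable (u t) (volume.restrict Ω) := fun t ht =>
    (contDiffOn_slice (h.contDiffOn_velocity hτ) ht).continuousOn.aestronglyMeasurable
      hΩ.measurableSet
  have hjoint : Integrable (fun z : ℝ × E3 => inner ℝ (convection (u z.1) z.2) (v z.2))
      ((volume.restrict (Ioc s t)).prod (volume.restrict Ω)) := by
    have hb := ((h.integrable_prod_sq hΩ hτ hE hs ht).const_mul (M ^ 2)).add
      (hv2.comp_snd (volume.restrict (Ioc s t)))
    refine hb.mono' ?_ ?_
    · rw [Measure.prod_restrict]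
      exact ((hN.mono (prod_mono_left hsub)).inner (hv.comp continuousOn_snd fun z hz =>
        hz.2)).aestronglyMeasurable (measurableSet_Ioc.prod hΩ.measurableSet)
    · rw [Measure.prod_restrict]
      refine (ae_restrict_iff' (measurableSet_Ioc.prod hΩ.measurableSet)).2
        (ae_of_all _ fun z hz => ?_)
      have h1 := norm_convection_le (hM z.1 (hsub hz.1) z.2 hz.2)
      have h2 := norm_inner_le_norm (𝕜 := ℝ) (convection (u z.1) z.2) (v z.2)
      have h3 : ‖convection (u z.1) z.2‖ * ‖v z.2‖ ≤ M * ‖u z.1 z.2‖ * ‖v z.2‖ := by gcongr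
      simp only [Pi.add_apply]
      nlinarith [sq_nonneg (M * ‖u z.1 z.2‖ - ‖v z.2‖), sq_nonneg (M * ‖u z.1 z.2‖),
        sq_nonneg ‖v z.2‖]
  have hinner : ∀ x ∈ Ω, inner ℝ (∫ r in s..t, convection (u r) x) (v x)
      = ∫ r in Ioc s t, inner ℝ (convection (u r) x) (v x) := by
    intro x hx
    have hc : IntervalIntegrable (fun r => convection (u r) x) volume s t :=
      ((continuousOn_time_slice hN hx).mono (Icc_subset_Icc hs.1
        ht.2)).intervalIntegrable_of_Icc hst
    have h1 := (innerSL ℝ (v x)).intervalIntegral_comp_comm hc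
    simp only [innerSL_apply_apply] at h1
    rw [real_inner_comm, ← h1, intervalIntegral.integral_of_le hst]
    simp_rw [real_inner_comm]
  have hK : IntegrableOn (fun x => inner ℝ (∫ r in s..t, convection (u r) x) (v x)) Ω := by
    have h1 : IntegrableOn (fun x => ∫ r in Ioc s t, inner ℝ (convection (u r) x) (v x)) Ω :=
      hjoint.integral_prod_right
    exact h1.congr_fun (fun x hx => (hinner x hx).symm) hΩ.measurableSet
  have hd : IntegrableOn (fun x => inner ℝ (u t x - u s x) (v x)) Ω := by
    have h1 := integrable_inner_of_sq (hut t ht) hvm (hE t ht).1 hv2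
    have h2 := integrable_inner_of_sq (hut s hs) hvm (hE s hs).1 hv2
    exact (h1.sub h2).congr (ae_of_all _ fun x => by simp [inner_sub_left])
  refine ⟨?_, ?_⟩
  · rw [intervalIntegrable_iff_integrableOn_Ioc_of_le hst]
    exact hjoint.integral_prod_left
  · simp only [momentumDefect, inner_add_left] at horth
    rw [integral_add hd hK, setIntegral_congr_fun hΩ.measurableSet hinner,
      integral_integral_swap (f := fun x r => inner ℝ (convection (u r) x) (v x))
        hjoint.swap] at horth
    rw [intervalIntegral.integral_of_le hst]
    linarith

/-- The momentum defect of a flow with bounded energy is square integrable. -/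
lemma IsSmoothVorticityFlow.integrableOn_momentumDefect_sq (h : IsSmoothVorticityFlow Ω T u ω)
    (hΩ : IsOpen Ω) (hτ : τ ∈ timeInterval T) (hτ0 : 0 < τ)
    (hE : ∀ t ∈ Icc 0 τ, IntegrableOn (fun x => ‖u t x‖ ^ 2) Ω ∧ ∫ x in Ω, ‖u t x‖ ^ 2 ≤ E)
    (hM : ∀ t ∈ Icc 0 τ, ∀ x ∈ Ω, ‖fderiv ℝ (u t) x‖ ≤ M)
    {s t : ℝ} (hs : s ∈ Icc 0 τ) (ht : t ∈ Icc 0 τ) (hst : s ≤ t) :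
    IntegrableOn (fun x => ‖momentumDefect u s t x‖ ^ 2) Ω := by
  have hN := (h.contDiffOn_convection hΩ hτ hτ0).continuousOn
  have hb : IntegrableOn (fun x => ∫ r in Ioc s t, ‖u r x‖ ^ 2) Ω :=
    (h.integrable_prod_sq hΩ hτ hE hs ht).integral_prod_right
  refine Integrable.mono' ((((hE t ht).1.const_mul 3).add ((hE s hs).1.const_mul 3)).add
    (hb.const_mul (3 * ((t - s) * M ^ 2)))) ?_ ((ae_restrict_iff' hΩ.measurableSet).2
      (ae_of_all _ fun x hx => ?_))
  · exact ((h.differentiableOn_momentumDefect hΩ hτ hτ0 hs ht).continuousOn.norm.pow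
      2).aestronglyMeasurable hΩ.measurableSet
  · have hst' : Icc s t ⊆ Icc 0 τ := Icc_subset_Icc hs.1 ht.2
    have hNx : ContinuousOn (fun r => convection (u r) x) (Icc s t) :=
      (continuousOn_time_slice hN hx).mono hst'
    have hux : ContinuousOn (fun r => u r x) (Icc s t) :=
      (continuousOn_time_slice (h.contDiffOn_velocity hτ).continuousOn hx).mono hst'
    have h1 : ∫ r in s..t, ‖convection (u r) x‖ ^ 2 ≤ M ^ 2 * ∫ r in Ioc s t, ‖u r x‖ ^ 2 := by
      rw [← intervalIntegral.integral_of_le hst, ← intervalIntegral.integral_const_mul]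
      refine intervalIntegral.integral_mono_on hst
        ((hNx.norm.pow 2).intervalIntegrable_of_Icc hst)
        (((hux.norm.pow 2).const_mul _).intervalIntegrable_of_Icc hst) fun r hr => ?_
      rw [← mul_pow]
      exact pow_le_pow_left₀ (norm_nonneg _) (norm_convection_le (hM r (hst' hr) x hx)) 2
    have h2 := (norm_integral_sq_le hst hNx).trans
      (mul_le_mul_of_nonneg_left h1 (sub_nonneg.2 hst))
    have h3 : ‖momentumDefect u s t x‖ ≤ ‖u t x‖ + ‖u s x‖ + ‖∫ r in s..t, convection (u r) x‖ :=
      (norm_add_le _ _).trans (add_le_add_left (norm_sub_le _ _) _)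
    simp only [Pi.add_apply]
    rw [norm_pow, norm_norm]
    have h4 := pow_le_pow_left₀ (norm_nonneg _) h3 2
    nlinarith [sq_nonneg (‖u t x‖ - ‖u s x‖),
      sq_nonneg (‖u t x‖ - ‖∫ r in s..t, convection (u r) x‖),
      sq_nonneg (‖u s x‖ - ‖∫ r in s..t, convection (u r) x‖)]

end Flow

/-- Pointwise energy balance of the convective terms for the difference `a - b` of two fields. -/
lemma inner_convection_sub {a b : E3 → E3} {x : E3} (ha : DifferentiableAt ℝ a x)
    (hb : DifferentiableAt ℝ b x) :
    inner ℝ (convection a x - convection b x) (a x - b x)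
      = 1 / 2 * fderiv ℝ (fun y => ‖a y - b y‖ ^ 2) x (a x)
        + inner ℝ (fderiv ℝ b x (a x - b x)) (a x - b x) := by
  have h1 : HasFDerivAt (fun y => ‖a y - b y‖ ^ 2) _ x :=
    (ha.hasFDerivAt.sub hb.hasFDerivAt).norm_sq
  rw [h1.fderiv]
  simp only [convection, map_sub, smul_apply, sub_apply, ContinuousLinearMap.comp_apply,
    innerSL_apply_apply, nsmul_eq_mul, Pi.sub_apply, inner_sub_right,
    real_inner_comm (a x), real_inner_comm (b x)]
  push_cast
  ring

/-- Two flows with bounded energy and the same initial velocity agree, provided that the difference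
of their velocities is orthogonal to the momentum defects, and its energy density is transported
without loss by the first velocity. -/
theorem IsSmoothVorticityFlow.velocity_unique {Ω : Set E3} {T : EReal} {u₁ ω₁ u₂ ω₂ : ℝ → E3 → E3}
    {τ E M : ℝ} (h₁ : IsSmoothVorticityFlow Ω T u₁ ω₁) (h₂ : IsSmoothVorticityFlow Ω T u₂ ω₂)
    (hΩ : IsOpen Ω) (hτ : τ ∈ timeInterval T) (hτ0 : 0 < τ)
    (hE₁ : ∀ t ∈ Icc 0 τ, IntegrableOn (fun x => ‖u₁ t x‖ ^ 2) Ω ∧ ∫ x in Ω, ‖u₁ t x‖ ^ 2 ≤ E)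
    (hE₂ : ∀ t ∈ Icc 0 τ, IntegrableOn (fun x => ‖u₂ t x‖ ^ 2) Ω ∧ ∫ x in Ω, ‖u₂ t x‖ ^ 2 ≤ E)
    (hM₁ : ∀ t ∈ Icc 0 τ, ∀ x ∈ Ω, ‖fderiv ℝ (u₁ t) x‖ ≤ M)
    (hM₂ : ∀ t ∈ Icc 0 τ, ∀ x ∈ Ω, ‖fderiv ℝ (u₂ t) x‖ ≤ M)
    (horth₁ : ∀ s ∈ Icc 0 τ, ∀ t ∈ Icc 0 τ, s ≤ t → ∀ a ∈ Icc 0 τ,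
      ∫ x in Ω, inner ℝ (momentumDefect u₁ s t x) (u₁ a x - u₂ a x) = 0)
    (horth₂ : ∀ s ∈ Icc 0 τ, ∀ t ∈ Icc 0 τ, s ≤ t → ∀ a ∈ Icc 0 τ,
      ∫ x in Ω, inner ℝ (momentumDefect u₂ s t x) (u₁ a x - u₂ a x) = 0)
    (hskew : ∀ r ∈ Icc 0 τ, ∫ x in Ω, fderiv ℝ (fun y => ‖u₁ r y - u₂ r y‖ ^ 2) x (u₁ r x) = 0)
    (h0 : ∀ x ∈ Ω, u₁ 0 x = u₂ 0 x) :
    ∀ t ∈ Icc 0 τ, ∀ x ∈ Ω, u₁ t x = u₂ t x := by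
  set μ := volume.restrict Ω with hμ
  have hc₁ : ∀ t ∈ Icc 0 τ, ContinuousOn (u₁ t) Ω := fun t ht =>
    (contDiffOn_slice (h₁.contDiffOn_velocity hτ) ht).continuousOn
  have hc₂ : ∀ t ∈ Icc 0 τ, ContinuousOn (u₂ t) Ω := fun t ht =>
    (contDiffOn_slice (h₂.contDiffOn_velocity hτ) ht).continuousOn
  have hd₁ : ∀ t ∈ Icc 0 τ, ∀ x ∈ Ω, DifferentiableAt ℝ (u₁ t) x := fun t ht x hx =>
    ((contDiffOn_slice (h₁.contDiffOn_velocity hτ) ht).contDiffAt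
      (hΩ.mem_nhds hx)).differentiableAt (by simp)
  have hd₂ : ∀ t ∈ Icc 0 τ, ∀ x ∈ Ω, DifferentiableAt ℝ (u₂ t) x := fun t ht x hx =>
    ((contDiffOn_slice (h₂.contDiffOn_velocity hτ) ht).contDiffAt
      (hΩ.mem_nhds hx)).differentiableAt (by simp)
  have hN₁ : ∀ t ∈ Icc 0 τ, ContinuousOn (convection (u₁ t)) Ω := fun t ht =>
    (contDiffOn_slice (h₁.contDiffOn_convection hΩ hτ hτ0) ht).continuousOn
  have hN₂ : ∀ t ∈ Icc 0 τ, ContinuousOn (convection (u₂ t)) Ω := fun t ht =>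
    (contDiffOn_slice (h₂.contDiffOn_convection hΩ hτ hτ0) ht).continuousOn
  set w : ℝ → E3 → E3 := fun t x => u₁ t x - u₂ t x with hw
  set g : ℝ → E3 → E3 := fun t x => -(convection (u₁ t) x - convection (u₂ t) x) with hg
  have hwc : ∀ t ∈ Icc 0 τ, ContinuousOn (w t) Ω := fun t ht => (hc₁ t ht).sub (hc₂ t ht)
  have hgc : ∀ t ∈ Icc 0 τ, ContinuousOn (g t) Ω := fun t ht => ((hN₁ t ht).sub (hN₂ t ht)).neg
  have hwm : ∀ t ∈ Icc 0 τ, AEStronglyMeasurable (w t) μ := fun t ht =>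
    (hwc t ht).aestronglyMeasurable hΩ.measurableSet
  have hgm : ∀ t ∈ Icc 0 τ, AEStronglyMeasurable (g t) μ := fun t ht =>
    (hgc t ht).aestronglyMeasurable hΩ.measurableSet
  have hw2 : ∀ t ∈ Icc 0 τ, Integrable (fun x => ‖w t x‖ ^ 2) μ := by
    intro t ht
    refine Integrable.mono' (((hE₁ t ht).1.add (hE₂ t ht).1).const_mul 2) ((hwm t ht).norm.pow 2)
      (ae_of_all _ fun x => ?_)
    rw [norm_pow, norm_norm]
    have h := pow_le_pow_left₀ (norm_nonneg _) (norm_sub_le (u₁ t x) (u₂ t x)) 2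
    simp only [Pi.add_apply, hw]
    nlinarith [sq_nonneg (‖u₁ t x‖ - ‖u₂ t x‖)]
  have hgle : ∀ t ∈ Icc 0 τ, ∀ x ∈ Ω,
      ‖g t x‖ ^ 2 ≤ 2 * M ^ 2 * (‖u₁ t x‖ ^ 2 + ‖u₂ t x‖ ^ 2) := by
    intro t ht x hx
    have h1 : ‖g t x‖ ≤ M * ‖u₁ t x‖ + M * ‖u₂ t x‖ := by
      rw [hg, norm_neg]
      exact (norm_sub_le _ _).trans (add_le_add (norm_convection_le (hM₁ t ht x hx))
        (norm_convection_le (hM₂ t ht x hx)))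
    have h2 := pow_le_pow_left₀ (norm_nonneg _) h1 2
    nlinarith [sq_nonneg (M * ‖u₁ t x‖ - M * ‖u₂ t x‖)]
  have hgb : ∀ t ∈ Icc 0 τ,
      Integrable (fun x => 2 * M ^ 2 * (‖u₁ t x‖ ^ 2 + ‖u₂ t x‖ ^ 2)) μ := fun t ht =>
    ((hE₁ t ht).1.add (hE₂ t ht).1).const_mul _
  have hg2 : ∀ t ∈ Icc 0 τ, Integrable (fun x => ‖g t x‖ ^ 2) μ := by
    intro t ht
    refine (hgb t ht).mono' ((hgm t ht).norm.pow 2)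
      ((ae_restrict_iff' hΩ.measurableSet).2 (ae_of_all _ fun x hx => ?_))
    rw [norm_pow, norm_norm]
    exact hgle t ht x hx
  have hwL : ∀ t ∈ Icc 0 τ, MemLp (w t) 2 μ := fun t ht =>
    (memLp_two_iff_integrable_sq_norm (hwm t ht)).2 (hw2 t ht)
  have hgL : ∀ t ∈ Icc 0 τ, MemLp (g t) 2 μ := fun t ht =>
    (memLp_two_iff_integrable_sq_norm (hgm t ht)).2 (hg2 t ht)
  classical
  -- the classes in `L²`; only the times in `[0, τ]` matter
  let W : ℝ → Lp E3 2 μ := fun t => if h : MemLp (w t) 2 μ then h.toLp (w t) else 0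
  let G : ℝ → Lp E3 2 μ := fun t => if h : MemLp (g t) 2 μ then h.toLp (g t) else 0
  have hW : ∀ t ∈ Icc 0 τ, W t =ᵐ[μ] w t := fun t ht => by
    simp only [W, hwL t ht, dite_true]
    exact (hwL t ht).coeFn_toLp
  have hG : ∀ t ∈ Icc 0 τ, G t =ᵐ[μ] g t := fun t ht => by
    simp only [G, hgL t ht, dite_true]
    exact (hgL t ht).coeFn_toLp
  have hGW : ∀ r ∈ Icc 0 τ, ∀ a ∈ Icc 0 τ,
      inner ℝ (G r) (W a) = ∫ x in Ω, inner ℝ (g r x) (w a x) := fun r hr a ha => by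
    rw [L2.inner_def]
    refine integral_congr_ae ?_
    filter_upwards [hG r hr, hW a ha] with x h1 h2
    rw [h1, h2]
  have hWW : ∀ a ∈ Icc 0 τ, ‖W a‖ ^ 2 = ∫ x in Ω, ‖w a x‖ ^ 2 := fun a ha => by
    rw [← real_inner_self_eq_norm_sq, L2.inner_def]
    refine integral_congr_ae ?_
    filter_upwards [hW a ha] with x h2
    rw [h2, real_inner_self_eq_norm_sq]
  have hz : (0 : ℝ) ∈ Icc 0 τ := ⟨le_rfl, hτ0.le⟩
  have hzero := eq_zero_of_weak_evolution (w := W) (G := G) (τ := τ) (M := M)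
    (C := Real.sqrt (4 * M ^ 2 * E)) (Real.sqrt_nonneg _) ?_ ?_ ?_ ?_
  · intro t ht x hx
    have h1 : w t =ᵐ[μ] fun _ => 0 := by
      have h2 := hW t ht
      rw [hzero t ht] at h2
      exact h2.symm.trans (Lp.coeFn_zero _ _ _)
    have h2 := Measure.eqOn_open_of_ae_eq h1 hΩ (hwc t ht) continuousOn_const hx
    exact sub_eq_zero.1 h2
  · intro r hr
    refine Real.le_sqrt_of_sq_le ?_
    have h1 : ‖G r‖ ^ 2 = ∫ x in Ω, ‖g r x‖ ^ 2 := by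
      rw [← real_inner_self_eq_norm_sq, L2.inner_def]
      refine integral_congr_ae ?_
      filter_upwards [hG r hr] with x h2
      rw [h2, real_inner_self_eq_norm_sq]
    rw [h1]
    calc ∫ x in Ω, ‖g r x‖ ^ 2 ≤ ∫ x in Ω, 2 * M ^ 2 * (‖u₁ r x‖ ^ 2 + ‖u₂ r x‖ ^ 2) :=
          setIntegral_mono_on (hg2 r hr) (hgb r hr) hΩ.measurableSet (hgle r hr)
      _ = 2 * M ^ 2 * ((∫ x in Ω, ‖u₁ r x‖ ^ 2) + ∫ x in Ω, ‖u₂ r x‖ ^ 2) := by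
          rw [integral_const_mul, integral_add (hE₁ r hr).1 (hE₂ r hr).1]
      _ ≤ 4 * M ^ 2 * E := by
          nlinarith [(hE₁ r hr).2, (hE₂ r hr).2, sq_nonneg M]
  · intro s hs t ht hst a ha
    obtain ⟨i1, e1⟩ := h₁.weak_momentum hΩ hτ hτ0 hE₁ hM₁ hs ht hst (hwc a ha) (hw2 a ha)
      (horth₁ s hs t ht hst a ha)
    obtain ⟨i2, e2⟩ := h₂.weak_momentum hΩ hτ hτ0 hE₂ hM₂ hs ht hst (hwc a ha) (hw2 a ha)
      (horth₂ s hs t ht hst a ha)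
    have hm : ∀ {f : E3 → E3}, ContinuousOn f Ω → AEStronglyMeasurable f μ := fun hf =>
      hf.aestronglyMeasurable hΩ.measurableSet
    have hconv2 : ∀ r ∈ Icc 0 τ, Integrable (fun x => ‖convection (u₁ r) x‖ ^ 2) μ ∧
        Integrable (fun x => ‖convection (u₂ r) x‖ ^ 2) μ := by
      intro r hr
      refine ⟨Integrable.mono' ((hE₁ r hr).1.const_mul (M ^ 2)) ((hm (hN₁ r hr)).norm.pow 2)
        ((ae_restrict_iff' hΩ.measurableSet).2 (ae_of_all _ fun x hx => ?_)),
        Integrable.mono' ((hE₂ r hr).1.const_mul (M ^ 2)) ((hm (hN₂ r hr)).norm.pow 2)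
        ((ae_restrict_iff' hΩ.measurableSet).2 (ae_of_all _ fun x hx => ?_))⟩
      · rw [norm_pow, norm_norm, ← mul_pow]
        exact pow_le_pow_left₀ (norm_nonneg _) (norm_convection_le (hM₁ r hr x hx)) 2
      · rw [norm_pow, norm_norm, ← mul_pow]
        exact pow_le_pow_left₀ (norm_nonneg _) (norm_convection_le (hM₂ r hr x hx)) 2
    have hsplit : ∀ r ∈ uIcc s t, inner ℝ (G r) (W a)
        = (∫ x in Ω, inner ℝ (convection (u₂ r) x) (w a x))
          - ∫ x in Ω, inner ℝ (convection (u₁ r) x) (w a x) := by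
      intro r hr
      rw [uIcc_of_le hst] at hr
      have hr' : r ∈ Icc 0 τ := ⟨hs.1.trans hr.1, hr.2.trans ht.2⟩
      rw [hGW r hr' a ha, ← integral_sub
        (integrable_inner_of_sq (hm (hN₂ r hr')) (hwm a ha) (hconv2 r hr').2 (hw2 a ha))
        (integrable_inner_of_sq (hm (hN₁ r hr')) (hwm a ha) (hconv2 r hr').1 (hw2 a ha))]
      refine integral_congr_ae (ae_of_all _ fun x => ?_)
      simp only [hg]
      rw [neg_sub, inner_sub_left]
    refine ⟨(i2.sub i1).congr fun r hr => (hsplit r (uIoc_subset_uIcc hr)).symm, ?_⟩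
    rw [intervalIntegral.integral_congr hsplit, intervalIntegral.integral_sub i2 i1]
    have h3 : inner ℝ (W t - W s) (W a) = ∫ x in Ω, inner ℝ (w t x - w s x) (w a x) := by
      rw [L2.inner_def]
      refine integral_congr_ae ?_
      filter_upwards [hW t ht, hW s hs, hW a ha, Lp.coeFn_sub (W t) (W s)] with x h1 h2 h3 h4
      rw [h4, Pi.sub_apply, h1, h2, h3]
    have i3 : Integrable (fun x => inner ℝ (u₁ t x - u₁ s x) (w a x)) μ :=
      ((integrable_inner_of_sq (hm (hc₁ t ht)) (hwm a ha) (hE₁ t ht).1 (hw2 a ha)).sub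
        (integrable_inner_of_sq (hm (hc₁ s hs)) (hwm a ha) (hE₁ s hs).1 (hw2 a ha))).congr
        (ae_of_all _ fun x => by simp [inner_sub_left])
    have i4 : Integrable (fun x => inner ℝ (u₂ t x - u₂ s x) (w a x)) μ :=
      ((integrable_inner_of_sq (hm (hc₂ t ht)) (hwm a ha) (hE₂ t ht).1 (hw2 a ha)).sub
        (integrable_inner_of_sq (hm (hc₂ s hs)) (hwm a ha) (hE₂ s hs).1 (hw2 a ha))).congr
        (ae_of_all _ fun x => by simp [inner_sub_left])
    have h4 : ∫ x in Ω, inner ℝ (w t x - w s x) (w a x)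
        = (∫ x in Ω, inner ℝ (u₁ t x - u₁ s x) (w a x))
          - ∫ x in Ω, inner ℝ (u₂ t x - u₂ s x) (w a x) := by
      rw [← integral_sub i3 i4]
      refine integral_congr_ae (ae_of_all _ fun x => ?_)
      simp only [hw]
      rw [← inner_sub_left]
      congr 1
      abel
    rw [h3, h4, e1, e2]
    ring
  · intro r hr
    rw [hGW r hr r hr, hWW r hr, ← integral_const_mul]
    have hQi : Integrable (fun x => inner ℝ (fderiv ℝ (u₂ r) x (w r x)) (w r x)) μ := by
      refine Integrable.mono' ((hw2 r hr).const_mul M) ?_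
        ((ae_restrict_iff' hΩ.measurableSet).2 (ae_of_all _ fun x hx => ?_))
      · have h1 : ContinuousOn (fun x => fderiv ℝ (u₂ r) x) Ω :=
          (contDiffOn_slice (contDiffOn_fderiv_slice hΩ hτ0 (h₂.contDiffOn_velocity hτ))
            hr).continuousOn
        exact ((h1.clm_apply (hwc r hr)).inner (hwc r hr)).aestronglyMeasurable hΩ.measurableSet
      · refine (norm_inner_le_norm _ _).trans ?_
        rw [sq, ← mul_assoc]
        exact mul_le_mul_of_nonneg_right ((ContinuousLinearMap.le_opNorm _ _).trans
          (mul_le_mul_of_nonneg_right (hM₂ r hr x hx) (norm_nonneg _))) (norm_nonneg _)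
    have hgi : Integrable (fun x => inner ℝ (g r x) (w r x)) μ :=
      integrable_inner_of_sq (hgm r hr) (hwm r hr) (hg2 r hr) (hw2 r hr)
    have hpt : ∀ x ∈ Ω, inner ℝ (g r x) (w r x)
        + inner ℝ (fderiv ℝ (u₂ r) x (w r x)) (w r x)
        = -(1 / 2) * fderiv ℝ (fun y => ‖u₁ r y - u₂ r y‖ ^ 2) x (u₁ r x) := by
      intro x hx
      have h1 := inner_convection_sub (hd₁ r hr x hx) (hd₂ r hr x hx)
      simp only [hg, hw, inner_neg_left]
      rw [h1]
      ring
    have h1 : ∫ x in Ω, inner ℝ (g r x) (w r x)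
        = -∫ x in Ω, inner ℝ (fderiv ℝ (u₂ r) x (w r x)) (w r x) := by
      have h2 := setIntegral_congr_fun (μ := volume) hΩ.measurableSet hpt
      rw [integral_add hgi hQi, integral_const_mul, hskew r hr] at h2
      linarith
    rw [h1, ← integral_neg]
    refine setIntegral_mono_on hQi.neg ((hw2 r hr).const_mul M) hΩ.measurableSet fun x hx => ?_
    refine (neg_le_abs _).trans ((abs_real_inner_le_norm _ _).trans ?_)
    rw [sq, ← mul_assoc]
    exact mul_le_mul_of_nonneg_right ((ContinuousLinearMap.le_opNorm _ _).trans
      (mul_le_mul_of_nonneg_right (hM₂ r hr x hx) (norm_nonneg _))) (norm_nonneg _)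
  · have h1 : W 0 =ᵐ[μ] fun _ => 0 := by
      refine (hW 0 hz).trans ((ae_restrict_iff' hΩ.measurableSet).2 (ae_of_all _ fun x hx => ?_))
      simp [hw, h0 x hx]
    exact (Lp.eq_zero_iff_ae_eq_zero).2 h1

/-! ### Uniqueness -/

lemma divergence_sub {a b : E3 → E3} {x : E3} (ha : DifferentiableAt ℝ a x)
    (hb : DifferentiableAt ℝ b x) :
    divergence (fun y => a y - b y) x = divergence a x - divergence b x := by
  simp only [divergence, partialDeriv, fderiv_fun_sub ha hb, ← Finset.sum_sub_distrib]
  rfl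

lemma curl_sub {a b : E3 → E3} {x : E3} (ha : DifferentiableAt ℝ a x)
    (hb : DifferentiableAt ℝ b x) : curl (fun y => a y - b y) x = curl a x - curl b x := by
  rw [curl_eq_curlMap, fderiv_fun_sub ha hb, map_sub]
  rfl

lemma norm_fderiv_norm_sq_le {a : E3 → E3} {x : E3} (ha : DifferentiableAt ℝ a x) :
    ‖fderiv ℝ (fun y => ‖a y‖ ^ 2) x‖ ≤ 2 * (‖a x‖ * ‖fderiv ℝ a x‖) := by
  have h : HasFDerivAt (fun y => ‖a y‖ ^ 2) _ x := ha.hasFDerivAt.norm_sq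
  rw [h.fderiv, two_smul, two_mul]
  have h1 : ‖(innerSL ℝ (a x)).comp (fderiv ℝ a x)‖ ≤ ‖a x‖ * ‖fderiv ℝ a x‖ := by
    refine (ContinuousLinearMap.opNorm_comp_le _ _).trans ?_
    rw [innerSL_apply_norm]
  exact (norm_add_le _ _).trans (add_le_add h1 h1)

lemma eqOn_zero_of_integral_inner_self {Ω : Set E3} (hΩ : IsOpen Ω) {f : E3 → E3}
    (hf : ContinuousOn f Ω) (hf2 : IntegrableOn (fun x => ‖f x‖ ^ 2) Ω)
    (h : ∫ x in Ω, inner ℝ (f x) (f x) = 0) : ∀ x ∈ Ω, f x = 0 := by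
  simp_rw [real_inner_self_eq_norm_sq] at h
  rw [integral_eq_zero_iff_of_nonneg (fun x => by positivity) hf2] at h
  have h1 : f =ᵐ[volume.restrict Ω] fun _ => 0 := by
    filter_upwards [h] with x hx
    exact norm_eq_zero.1 (pow_eq_zero_iff two_ne_zero |>.1 hx)
  exact fun x hx => Measure.eqOn_open_of_ae_eq h1 hΩ hf continuousOn_const hx

section Flow

variable {Ω : Set E3} {T : EReal} {u ω u₁ ω₁ u₂ ω₂ : ℝ → E3 → E3}

lemma IsSmoothVorticityFlow.contDiffOn_velocity_slice (h : IsSmoothVorticityFlow Ω T u ω) {t : ℝ}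
    (ht : t ∈ timeInterval T) : ContDiffOn ℝ 1 (u t) Ω :=
  (contDiffOn_slice (h.contDiffOn_velocity ht) ⟨ht.1, le_rfl⟩).of_le
    (WithTop.coe_le_coe.2 (le_top : (1 : ℕ∞) ≤ ⊤))

lemma IsSmoothVorticityFlow.differentiableAt_velocity (h : IsSmoothVorticityFlow Ω T u ω)
    (hΩ : IsOpen Ω) {t : ℝ} (ht : t ∈ timeInterval T) {x : E3} (hx : x ∈ Ω) :
    DifferentiableAt ℝ (u t) x :=
  ((h.contDiffOn_velocity_slice ht).contDiffAt (hΩ.mem_nhds hx)).differentiableAt one_ne_zero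

lemma IsSmoothVorticityFlow.divergence_sub_eq_zero (h₁ : IsSmoothVorticityFlow Ω T u₁ ω₁)
    (h₂ : IsSmoothVorticityFlow Ω T u₂ ω₂) (hΩ : IsOpen Ω) {t : ℝ} (ht : t ∈ timeInterval T)
    {x : E3} (hx : x ∈ Ω) : divergence (fun y => u₁ t y - u₂ t y) x = 0 := by
  rw [divergence_sub (h₁.differentiableAt_velocity hΩ ht hx)
    (h₂.differentiableAt_velocity hΩ ht hx), h₁.divergence_free t ht x hx,
    h₂.divergence_free t ht x hx, sub_zero]

lemma IsSmoothVorticityFlow.curl_sub_eq_zero (h₁ : IsSmoothVorticityFlow Ω T u₁ ω₁)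
    (h₂ : IsSmoothVorticityFlow Ω T u₂ ω₂) (hΩ : IsOpen Ω) {t : ℝ} (ht : t ∈ timeInterval T)
    {x : E3} (hx : x ∈ Ω) (hω : ω₁ t x = ω₂ t x) : curl (fun y => u₁ t y - u₂ t y) x = 0 := by
  rw [curl_sub (h₁.differentiableAt_velocity hΩ ht hx)
    (h₂.differentiableAt_velocity hΩ ht hx), ← h₁.vorticity_eq_curl t ht x hx,
    ← h₂.vorticity_eq_curl t ht x hx, hω, sub_self]

lemma IsSmoothVorticityFlow.vorticity_eq_of_velocity_eq (h₁ : IsSmoothVorticityFlow Ω T u₁ ω₁)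
    (h₂ : IsSmoothVorticityFlow Ω T u₂ ω₂) (hΩ : IsOpen Ω) {t : ℝ} (ht : t ∈ timeInterval T)
    (hu : ∀ x ∈ Ω, u₁ t x = u₂ t x) {x : E3} (hx : x ∈ Ω) : ω₁ t x = ω₂ t x := by
  have h : u₁ t =ᶠ[𝓝 x] u₂ t := by
    filter_upwards [hΩ.mem_nhds hx] with y hy using hu y hy
  rw [h₁.vorticity_eq_curl t ht x hx, h₂.vorticity_eq_curl t ht x hx, curl_eq_curlMap,
    curl_eq_curlMap, h.fderiv_eq]

lemma IsSmoothVorticityFlow.exists_common_gradient_bound (h₁ : IsSmoothVorticityFlow Ω T u₁ ω₁)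
    (h₂ : IsSmoothVorticityFlow Ω T u₂ ω₂) {τ : ℝ} (hτ : τ ∈ timeInterval T) :
    ∃ M : ℝ, 0 ≤ M ∧ (∀ t ∈ Icc 0 τ, ∀ x ∈ Ω, ‖fderiv ℝ (u₁ t) x‖ ≤ M) ∧
      ∀ t ∈ Icc 0 τ, ∀ x ∈ Ω, ‖fderiv ℝ (u₂ t) x‖ ≤ M := by
  obtain ⟨M₁, hM₁⟩ := h₁.bounded_gradient τ hτ
  obtain ⟨M₂, hM₂⟩ := h₂.bounded_gradient τ hτ
  exact ⟨max 0 (max M₁ M₂), le_max_left _ _,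
    fun t ht x hx => (hM₁ t ht x hx).trans ((le_max_left _ _).trans (le_max_right _ _)),
    fun t ht x hx => (hM₂ t ht x hx).trans ((le_max_right _ _).trans (le_max_right _ _))⟩

lemma integrable_norm_sub_sq {μ : Measure E3} {a b : E3 → E3} (ha : AEStronglyMeasurable a μ)
    (hb : AEStronglyMeasurable b μ) (ha2 : Integrable (fun x => ‖a x‖ ^ 2) μ)
    (hb2 : Integrable (fun x => ‖b x‖ ^ 2) μ) : Integrable (fun x => ‖a x - b x‖ ^ 2) μ :=
  (memLp_two_iff_integrable_sq_norm (ha.sub hb)).1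
    (((memLp_two_iff_integrable_sq_norm ha).2 ha2).sub
      ((memLp_two_iff_integrable_sq_norm hb).2 hb2))

end Flow

/-- Uniqueness in the whole space. -/
theorem IsWholeSpaceSolution.velocity_unique {T : EReal} {u₁ ω₁ u₂ ω₂ : ℝ → E3 → E3}
    (h₁ : IsWholeSpaceSolution T u₁ ω₁) (h₂ : IsWholeSpaceSolution T u₂ ω₂)
    (h0 : ∀ x, ω₁ 0 x = ω₂ 0 x) {τ : ℝ} (hτ : τ ∈ timeInterval T) (x : E3) :
    u₁ τ x = u₂ τ x := by
  have f₁ := h₁.toIsSmoothVorticityFlow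
  have f₂ := h₂.toIsSmoothVorticityFlow
  have hI := Icc_subset_timeInterval hτ
  have hsm₁ : ∀ t ∈ Icc 0 τ, ContDiff ℝ 1 (u₁ t) := fun t ht =>
    contDiffOn_univ.1 (f₁.contDiffOn_velocity_slice (hI ht))
  have hsm₂ : ∀ t ∈ Icc 0 τ, ContDiff ℝ 1 (u₂ t) := fun t ht =>
    contDiffOn_univ.1 (f₂.contDiffOn_velocity_slice (hI ht))
  obtain ⟨E₁, hE₁⟩ := h₁.finite_energy τ hτ
  obtain ⟨E₂, hE₂⟩ := h₂.finite_energy τ hτ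
  obtain ⟨M, hM0, hM₁, hM₂⟩ := f₁.exists_common_gradient_bound f₂ hτ
  have hw : ∀ t ∈ Icc 0 τ, ContDiff ℝ 1 fun y => u₁ t y - u₂ t y := fun t ht =>
    (hsm₁ t ht).sub (hsm₂ t ht)
  have hwdiv : ∀ t ∈ Icc 0 τ, ∀ x, divergence (fun y => u₁ t y - u₂ t y) x = 0 := fun t ht x =>
    f₁.divergence_sub_eq_zero f₂ isOpen_univ (hI ht) (mem_univ x)
  have hw2 : ∀ t ∈ Icc 0 τ, Integrable fun x => ‖u₁ t x - u₂ t x‖ ^ 2 := fun t ht =>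
    integrable_norm_sub_sq (hsm₁ t ht).continuous.aestronglyMeasurable
      (hsm₂ t ht).continuous.aestronglyMeasurable (hE₁ t ht).1 (hE₂ t ht).1
  have hz : (0 : ℝ) ∈ Icc 0 τ := ⟨le_rfl, hτ.1⟩
  have hinit : ∀ x ∈ univ, u₁ 0 x = u₂ 0 x := by
    intro x hx
    refine sub_eq_zero.1 (eqOn_zero_of_integral_inner_self (f := fun y => u₁ 0 y - u₂ 0 y)
      isOpen_univ (hw 0 hz).continuous.continuousOn (hw2 0 hz).integrableOn ?_ x hx)
    rw [Measure.restrict_univ]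
    exact integral_inner_eq_zero_of_curl_eq_zero ((hw 0 hz).differentiable one_ne_zero)
      (fun x => f₁.curl_sub_eq_zero f₂ isOpen_univ (hI hz) (mem_univ x) (h0 x)) (hw 0 hz)
      (hwdiv 0 hz) (hw2 0 hz) (hw2 0 hz)
  -- the set `[0, τ] × Ω` supports unique differentials only if `0 < τ`
  rcases hτ.1.eq_or_lt with hτ0 | hτ0
  · rw [← hτ0]
    exact hinit x (mem_univ x)
  have hE₁' : ∀ t ∈ Icc 0 τ, IntegrableOn (fun x => ‖u₁ t x‖ ^ 2) univ ∧
      ∫ x in univ, ‖u₁ t x‖ ^ 2 ≤ max E₁ E₂ := fun t ht => by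
    rw [integrableOn_univ, Measure.restrict_univ]
    exact ⟨(hE₁ t ht).1, (hE₁ t ht).2.trans (le_max_left _ _)⟩
  have hE₂' : ∀ t ∈ Icc 0 τ, IntegrableOn (fun x => ‖u₂ t x‖ ^ 2) univ ∧
      ∫ x in univ, ‖u₂ t x‖ ^ 2 ≤ max E₁ E₂ := fun t ht => by
    rw [integrableOn_univ, Measure.restrict_univ]
    exact ⟨(hE₂ t ht).1, (hE₂ t ht).2.trans (le_max_right _ _)⟩
  refine f₁.velocity_unique f₂ isOpen_univ hτ hτ0 hE₁' hE₂' hM₁ hM₂ ?_ ?_ ?_ hinit τ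
    ⟨hτ.1, le_rfl⟩ x (mem_univ x)
  · intro s hs t ht hst a ha
    rw [Measure.restrict_univ]
    exact integral_inner_eq_zero_of_curl_eq_zero
      (differentiableOn_univ.1 (f₁.differentiableOn_momentumDefect isOpen_univ hτ hτ0 hs ht))
      (fun x => f₁.curl_momentumDefect isOpen_univ hτ hτ0 hs ht hst (mem_univ x)) (hw a ha)
      (hwdiv a ha)
      (integrableOn_univ.1
        (f₁.integrableOn_momentumDefect_sq isOpen_univ hτ hτ0 hE₁' hM₁ hs ht hst))
      (hw2 a ha)
  · intro s hs t ht hst a ha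
    rw [Measure.restrict_univ]
    exact integral_inner_eq_zero_of_curl_eq_zero
      (differentiableOn_univ.1 (f₂.differentiableOn_momentumDefect isOpen_univ hτ hτ0 hs ht))
      (fun x => f₂.curl_momentumDefect isOpen_univ hτ hτ0 hs ht hst (mem_univ x)) (hw a ha)
      (hwdiv a ha)
      (integrableOn_univ.1
        (f₂.integrableOn_momentumDefect_sq isOpen_univ hτ hτ0 hE₂' hM₂ hs ht hst))
      (hw2 a ha)
  · intro r hr
    rw [Measure.restrict_univ]
    have hφ : ContDiff ℝ 1 fun y => ‖u₁ r y - u₂ r y‖ ^ 2 := (hw r hr).norm_sq ℝ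
    refine integral_fderiv_apply_eq_zero_of_integrable hφ (hsm₁ r hr)
      (fun x => f₁.divergence_free r (hI hr) x (mem_univ x)) ?_ ?_
    · refine Integrable.mono' (((hw2 r hr).add (hE₁ r hr).1).const_mul (2 * M)) ?_
        (ae_of_all _ fun x => ?_)
      · exact ((hφ.continuous_fderiv one_ne_zero).clm_apply
          (hsm₁ r hr).continuous).aestronglyMeasurable
      · have h1 := norm_fderiv_norm_sq_le ((hw r hr).differentiable one_ne_zero x)
        have h2 : ‖fderiv ℝ (fun y => u₁ r y - u₂ r y) x‖ ≤ 2 * M := by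
          rw [fderiv_fun_sub ((hsm₁ r hr).differentiable one_ne_zero x)
            ((hsm₂ r hr).differentiable one_ne_zero x), two_mul]
          exact (norm_sub_le _ _).trans
            (add_le_add (hM₁ r hr x (mem_univ x)) (hM₂ r hr x (mem_univ x)))
        refine (ContinuousLinearMap.le_opNorm _ _).trans ?_
        simp only [Pi.add_apply]
        set p := ‖u₁ r x - u₂ r x‖
        set q := ‖u₁ r x‖
        have hp : 0 ≤ p := norm_nonneg _
        have hq : 0 ≤ q := norm_nonneg _
        calc ‖fderiv ℝ (fun y => ‖u₁ r y - u₂ r y‖ ^ 2) x‖ * q ≤ 2 * (p * (2 * M)) * q := by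
              refine mul_le_mul_of_nonneg_right (h1.trans ?_) hq
              gcongr
          _ = 2 * M * (2 * (p * q)) := by ring
          _ ≤ 2 * M * (p ^ 2 + q ^ 2) := by
              refine mul_le_mul_of_nonneg_left ?_ (by positivity)
              nlinarith [sq_nonneg (p - q)]
    · -- a field with bounded gradient grows at most linearly
      have hlin : ∀ x, ‖u₁ r x‖ ≤ (‖u₁ r 0‖ + M) * (1 + ‖x‖) := by
        intro x
        have h1 := convex_univ.norm_image_sub_le_of_norm_fderiv_le (𝕜 := ℝ) (f := u₁ r) (C := M)
          (fun y _ => (hsm₁ r hr).differentiable one_ne_zero y) (fun y hy => hM₁ r hr y hy)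
          (mem_univ 0) (mem_univ x)
        rw [sub_zero] at h1
        have h2 := norm_sub_norm_le (u₁ r x) (u₁ r 0)
        nlinarith [norm_nonneg x, norm_nonneg (u₁ r 0),
          mul_nonneg (norm_nonneg (u₁ r 0)) (norm_nonneg x)]
      refine Integrable.mono' ((hw2 r hr).const_mul (‖u₁ r 0‖ + M)) ?_ (ae_of_all _ fun x => ?_)
      · have h1 := hφ.continuous
        have h2 := (hsm₁ r hr).continuous
        refine Continuous.aestronglyMeasurable (Continuous.div (by fun_prop) (by fun_prop)
          fun x => ?_)
        positivity
      · rw [Real.norm_eq_abs, abs_of_nonneg (by positivity), abs_of_nonneg (by positivity),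
          div_le_iff₀ (by positivity)]
        calc ‖u₁ r x - u₂ r x‖ ^ 2 * ‖u₁ r x‖
            ≤ ‖u₁ r x - u₂ r x‖ ^ 2 * ((‖u₁ r 0‖ + M) * (1 + ‖x‖)) := by
              gcongr
              exact hlin x
          _ = _ := by ring

/-- Uniqueness in a bounded, simply connected domain with impermeable `C²` boundary. -/
theorem IsImpermeableDomainSolution.velocity_unique {Ω : Set E3} (hΩ : IsOpen Ω)
    (hb : Bornology.IsBounded Ω) (hsc : SimplyConnectedSpace Ω) (hC2 : HasC2Boundary Ω)
    {T : EReal} {u₁ ω₁ u₂ ω₂ : ℝ → E3 → E3} (h₁ : IsImpermeableDomainSolution Ω T u₁ ω₁)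
    (h₂ : IsImpermeableDomainSolution Ω T u₂ ω₂) (h0 : ∀ x ∈ Ω, ω₁ 0 x = ω₂ 0 x) {τ : ℝ}
    (hτ : τ ∈ timeInterval T) : ∀ x ∈ Ω, u₁ τ x = u₂ τ x := by
  have f₁ := h₁.toIsSmoothVorticityFlow
  have f₂ := h₂.toIsSmoothVorticityFlow
  have hI := Icc_subset_timeInterval hτ
  have hsm₁ : ∀ t ∈ Icc 0 τ, ContDiffOn ℝ 1 (u₁ t) Ω := fun t ht =>
    f₁.contDiffOn_velocity_slice (hI ht)
  have hsm₂ : ∀ t ∈ Icc 0 τ, ContDiffOn ℝ 1 (u₂ t) Ω := fun t ht =>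
    f₂.contDiffOn_velocity_slice (hI ht)
  have hcl : IsCompact (Icc 0 τ ×ˢ closure Ω) := isCompact_Icc.prod hb.isCompact_closure
  have hcc₁ : ContinuousOn (fun z : ℝ × E3 => u₁ z.1 z.2) (Icc 0 τ ×ˢ closure Ω) :=
    h₁.continuous_velocity.mono (prod_mono_left hI)
  have hcc₂ : ContinuousOn (fun z : ℝ × E3 => u₂ z.1 z.2) (Icc 0 τ ×ˢ closure Ω) :=
    h₂.continuous_velocity.mono (prod_mono_left hI)
  obtain ⟨B₁, hB₁'⟩ := hcl.exists_bound_of_continuousOn hcc₁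
  obtain ⟨B₂, hB₂'⟩ := hcl.exists_bound_of_continuousOn hcc₂
  obtain ⟨M, hM0, hM₁, hM₂⟩ := f₁.exists_common_gradient_bound f₂ hτ
  set B := max 0 (max B₁ B₂)
  have hB0 : 0 ≤ B := le_max_left _ _
  have hB₁ : ∀ t ∈ Icc 0 τ, ∀ x ∈ Ω, ‖u₁ t x‖ ≤ B := fun t ht x hx =>
    (hB₁' (t, x) ⟨ht, subset_closure hx⟩).trans ((le_max_left _ _).trans (le_max_right _ _))
  have hB₂ : ∀ t ∈ Icc 0 τ, ∀ x ∈ Ω, ‖u₂ t x‖ ≤ B := fun t ht x hx =>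
    (hB₂' (t, x) ⟨ht, subset_closure hx⟩).trans ((le_max_right _ _).trans (le_max_right _ _))
  have hE : ∀ v : E3 → E3, ContinuousOn v Ω → (∀ x ∈ Ω, ‖v x‖ ≤ B) →
      IntegrableOn (fun x => ‖v x‖ ^ 2) Ω ∧ ∫ x in Ω, ‖v x‖ ^ 2 ≤ B ^ 2 * volume.real Ω := by
    intro v hv hvB
    have h1 : ∀ x ∈ Ω, |‖v x‖ ^ 2| ≤ B ^ 2 := fun x hx => by
      rw [abs_of_nonneg (by positivity)]
      exact pow_le_pow_left₀ (norm_nonneg _) (hvB x hx) 2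
    have h2 : ‖∫ x in Ω, ‖v x‖ ^ 2‖ ≤ B ^ 2 * volume.real Ω :=
      norm_setIntegral_le_of_norm_le_const hb.measure_lt_top h1
    exact ⟨integrableOn_of_continuousOn_of_abs_le hΩ hb (hv.norm.pow 2) h1,
      (le_abs_self _).trans h2⟩
  have hE₁ := fun t ht => hE (u₁ t) (hsm₁ t ht).continuousOn (hB₁ t ht)
  have hE₂ := fun t ht => hE (u₂ t) (hsm₂ t ht).continuousOn (hB₂ t ht)
  have hw : ∀ t ∈ Icc 0 τ, ContDiffOn ℝ 1 (fun y => u₁ t y - u₂ t y) Ω := fun t ht =>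
    (hsm₁ t ht).sub (hsm₂ t ht)
  have hwdiv : ∀ t ∈ Icc 0 τ, ∀ x ∈ Ω, divergence (fun y => u₁ t y - u₂ t y) x = 0 :=
    fun t ht x hx => f₁.divergence_sub_eq_zero f₂ hΩ (hI ht) hx
  have hslice : ∀ {u : ℝ → E3 → E3},
      ContinuousOn (fun z : ℝ × E3 => u z.1 z.2) (Icc 0 τ ×ˢ closure Ω) →
      ∀ t ∈ Icc 0 τ, ContinuousOn (u t) (closure Ω) := fun hu t ht =>
    hu.comp (f := fun x : E3 => (t, x)) (by fun_prop) fun x hx => ⟨ht, hx⟩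
  have hwc : ∀ t ∈ Icc 0 τ, ContinuousOn (fun y => u₁ t y - u₂ t y) (closure Ω) := fun t ht =>
    (hslice hcc₁ t ht).sub (hslice hcc₂ t ht)
  have hwtan : ∀ t ∈ Icc 0 τ, ∀ q ∈ frontier Ω, ∀ n, IsOutwardUnitNormal Ω q n →
      inner ℝ (u₁ t q - u₂ t q) n = 0 := fun t ht q hq n hn => by
    rw [inner_sub_left, h₁.zero_normal_velocity t (hI ht) q hq n hn,
      h₂.zero_normal_velocity t (hI ht) q hq n hn, sub_zero]
  have hwB : ∀ t ∈ Icc 0 τ, ∀ x ∈ Ω, ‖u₁ t x - u₂ t x‖ ≤ 2 * B := fun t ht x hx => by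
    rw [two_mul]
    exact (norm_sub_le _ _).trans (add_le_add (hB₁ t ht x hx) (hB₂ t ht x hx))
  have hz : (0 : ℝ) ∈ Icc 0 τ := ⟨le_rfl, hτ.1⟩
  have hinit : ∀ x ∈ Ω, u₁ 0 x = u₂ 0 x := by
    intro x hx
    refine sub_eq_zero.1 (eqOn_zero_of_integral_inner_self (f := fun y => u₁ 0 y - u₂ 0 y)
      hΩ (hw 0 hz).continuousOn (integrable_norm_sub_sq
        ((hsm₁ 0 hz).continuousOn.aestronglyMeasurable hΩ.measurableSet)
        ((hsm₂ 0 hz).continuousOn.aestronglyMeasurable hΩ.measurableSet)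
        (hE₁ 0 hz).1 (hE₂ 0 hz).1) ?_ x hx)
    exact setIntegral_inner_eq_zero_of_curl_eq_zero hΩ hb hsc hC2
      ((hw 0 hz).differentiableOn one_ne_zero)
      (fun x hx => f₁.curl_sub_eq_zero f₂ hΩ (hI hz) hx (h0 x hx)) (hwB 0 hz) (hw 0 hz)
      (hwdiv 0 hz) (hwc 0 hz) (hwtan 0 hz)
  -- the set `[0, τ] × Ω` supports unique differentials only if `0 < τ`
  rcases hτ.1.eq_or_lt with hτ0 | hτ0
  · rw [← hτ0]
    exact hinit
  have hdefect : ∀ {u ω : ℝ → E3 → E3}, IsSmoothVorticityFlow Ω T u ω →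
      (∀ t ∈ Icc 0 τ, ∀ x ∈ Ω, ‖u t x‖ ≤ B) →
      (∀ t ∈ Icc 0 τ, ∀ x ∈ Ω, ‖fderiv ℝ (u t) x‖ ≤ M) →
      ∀ s ∈ Icc 0 τ, ∀ t ∈ Icc 0 τ, s ≤ t → ∀ a ∈ Icc 0 τ,
        ∫ x in Ω, inner ℝ (momentumDefect u s t x) (u₁ a x - u₂ a x) = 0 := by
    intro u ω f huB huM s hs t ht hst a ha
    refine setIntegral_inner_eq_zero_of_curl_eq_zero (C := B + B + M * B * |t - s|) hΩ hb hsc hC2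
      (f.differentiableOn_momentumDefect hΩ hτ hτ0 hs ht)
      (fun x hx => f.curl_momentumDefect hΩ hτ hτ0 hs ht hst hx) (fun x hx => ?_) (hw a ha)
      (hwdiv a ha) (hwc a ha) (hwtan a ha)
    refine (norm_add_le _ _).trans (add_le_add ((norm_sub_le _ _).trans
      (add_le_add (huB t ht x hx) (huB s hs x hx))) ?_)
    refine intervalIntegral.norm_integral_le_of_norm_le_const fun r hr => ?_
    rw [uIoc_of_le hst] at hr
    have hr' : r ∈ Icc 0 τ := ⟨hs.1.trans hr.1.le, hr.2.trans ht.2⟩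
    exact (norm_convection_le (huM r hr' x hx)).trans
      (mul_le_mul_of_nonneg_left (huB r hr' x hx) hM0)
  refine fun x hx => f₁.velocity_unique f₂ hΩ hτ hτ0 hE₁ hE₂ hM₁ hM₂ (hdefect f₁ hB₁ hM₁)
    (hdefect f₂ hB₂ hM₂) (fun r hr => ?_) hinit τ ⟨hτ.1, le_rfl⟩ x hx
  refine setIntegral_fderiv_apply_eq_zero_of_tangential
    (C := max ((2 * B) ^ 2) (2 * (2 * B * (2 * M)))) hΩ hb hC2 (hsm₁ r hr)
    (f₁.divergence_free r (hI hr)) (hslice hcc₁ r hr) (h₁.zero_normal_velocity r (hI hr))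
    ((hw r hr).norm_sq ℝ) (fun x hx => ?_) fun x hx => ?_
  · rw [abs_of_nonneg (by positivity)]
    exact (pow_le_pow_left₀ (norm_nonneg _) (hwB r hr x hx) 2).trans (le_max_left _ _)
  · have hd₁ := f₁.differentiableAt_velocity hΩ (hI hr) hx
    have hd₂ := f₂.differentiableAt_velocity hΩ (hI hr) hx
    have h2 : ‖fderiv ℝ (fun y => u₁ r y - u₂ r y) x‖ ≤ 2 * M := by
      rw [fderiv_fun_sub hd₁ hd₂, two_mul]
      exact (norm_sub_le _ _).trans (add_le_add (hM₁ r hr x hx) (hM₂ r hr x hx))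
    refine (norm_fderiv_norm_sq_le (hd₁.fun_sub hd₂)).trans (le_trans ?_ (le_max_right _ _))
    exact mul_le_mul_of_nonneg_left (mul_le_mul (hwB r hr x hx) h2 (norm_nonneg _) (by positivity))
      zero_le_two

end Euler3D

theorem mainTheorem2 :
    (∀ (T : EReal), 0 < T → ∀ (u₁ ω₁ u₂ ω₂ : ℝ → Euler3D.E3 → Euler3D.E3),
      Euler3D.IsWholeSpaceSolution T u₁ ω₁ →
      Euler3D.IsWholeSpaceSolution T u₂ ω₂ →
      (∀ x : Euler3D.E3, ω₁ 0 x = ω₂ 0 x) →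
      ∀ t ∈ Euler3D.timeInterval T, ∀ x : Euler3D.E3,
        ω₁ t x = ω₂ t x ∧ u₁ t x = u₂ t x) ∧
    (∀ (Ω : Set Euler3D.E3), IsOpen Ω → Bornology.IsBounded Ω → SimplyConnectedSpace Ω →
      Euler3D.HasC2Boundary Ω →
      ∀ (T : EReal), 0 < T → ∀ (u₁ ω₁ u₂ ω₂ : ℝ → Euler3D.E3 → Euler3D.E3),
      Euler3D.IsImpermeableDomainSolution Ω T u₁ ω₁ →
      Euler3D.IsImpermeableDomainSolution Ω T u₂ ω₂ →
      (∀ x ∈ Ω, ω₁ 0 x = ω₂ 0 x) →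
      ∀ t ∈ Euler3D.timeInterval T, ∀ x ∈ Ω,
        ω₁ t x = ω₂ t x ∧ u₁ t x = u₂ t x) := by
  refine ⟨fun T _ u₁ ω₁ u₂ ω₂ h₁ h₂ h0 t ht x => ?_,
    fun Ω hΩ hb hsc hC2 T _ u₁ ω₁ u₂ ω₂ h₁ h₂ h0 t ht x hx => ?_⟩
  · have hu := fun y => h₁.velocity_unique h₂ h0 ht y
    exact ⟨h₁.toIsSmoothVorticityFlow.vorticity_eq_of_velocity_eq h₂.toIsSmoothVorticityFlow
      isOpen_univ ht (fun y _ => hu y) (Set.mem_univ x), hu x⟩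
  · have hu := h₁.velocity_unique hΩ hb hsc hC2 h₂ h0 ht
    exact ⟨h₁.toIsSmoothVorticityFlow.vorticity_eq_of_velocity_eq h₂.toIsSmoothVorticityFlow
      hΩ ht hu hx, hu x hx⟩
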